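/- Notation. For $X\in\mathbb{R}^{m\times n}$ with singular values $\sigma_1(X)\ge\dots\ge\sigma_{\min\{m,n\}}(X)\ge 0$ and $0<p<\infty$ let $\|X\|_{S_p}=\big(\sum_{j}\sigma_j(X)^p\big)^{1/p}$; for $z\in\mathbb{R}^L$ and $0<q<\infty$ let $\|z\|_q=\big(\sum_i|z_i|^q\big)^{1/q}$. Let $X_{\max(r)}$ denote a best approximation of $X$ by matrices of rank at most $r$ (in the Frobenius norm $\|\cdot\|_{S_2}$) and $X_{-\max(r)}=X-X_{\max(r)}$. A linear map $\mathcal{A}:\mathbb{R}^{m\times n}\to\mathbb{R}^L$ satisfies the $\ell_q$-restricted uniform boundedness ($\ell_q$-RUB) condition of order $N$ with constants $C_1,C_2$ if $$C_1\|X\|_{S_2}^q\le \|\mathcal{A}(X)\|_q^q/L\le C_2\|X\|_{S_2}^q$$ for all nonzero $X\in\mathbb{R}^{m\times n}$ of rank at most $N$. Theorem. Let $0<p\le q\le 1$, let $r$ be a positive integer, and let $k>1$ be a real number such that $kr$ is a positive integer. Suppose that the linear map $\mathcal{A}:\mathbb{R}^{m\times n}\to\mathbb{R}^L$ satisfies $\ell_q$-RUB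 of order $(k+1)r$ with constants $C_1>0$ and $C_2$ such that $C_2/C_1<k^{(1/p-1/2)q}$. Let $X\in\mathbb{R}^{m\times n}$ satisfy $\|X\|_{S_p}=1$, let $z\in\mathbb{R}^L$ and $b=\mathcal{A}(X)+z$, and let $\hat X$ be any solution of $$\min_{Y\in\mathbb{R}^{m\times n}}\|\mathcal{A}(Y)-b\|_q^q\quad\text{subject to}\quad \|Y\|_{S_p}=1 .$$ Put $D_1=(C_1L)^{-p/q}$ and $\beta_1=\big(C_2k^{-(1/p-1/2)q}/C_1\big)^{p/q}$. Then $D_1>0$, $0<\beta_1<1$, and $$\|\hat X-X\|_{S_2}^p\le \frac{2(1+\beta_1)^2}{1-\beta_1}\,\frac{\|X_{-\max(r)}\|_{S_p}^p}{r^{(1/p-1/2)p}}+\frac{2^{p/q}(3+\beta_1)D_1}{1-\beta_1}\,\|z\|_q^p .$$ -/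

import Mathlib

/-- The Schatten `p`-(quasi-)norm `(∑_{j ≤ min(m,n)} σ_j(X)^p)^{1/p}` of a real `m × n` matrix, for
`0 < p < ∞`. The singular values are those of the operator `ℝⁿ → ℝᵐ` between Euclidean spaces,
in decreasing order. -/
noncomputable def schattenNorm {m n : ℕ} (p : ℝ) (X : Matrix (Fin m) (Fin n) ℝ) : ℝ :=
  (∑ j ∈ Finset.range (min m n),
    (Matrix.toEuclideanLin X).singularValues j ^ p) ^ (1 / p)

/-- The `ℓ_q`-(quasi-)norm `(∑_i |z_i|^q)^{1/q}` of a vector, for `0 < q < ∞`. -/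
noncomputable def lqNorm {L : ℕ} (q : ℝ) (z : Fin L → ℝ) : ℝ :=
  (∑ i, |z i| ^ q) ^ (1 / q)

/-- `ℓ_q`-restricted uniform boundedness of order `r` with constants `C₁`, `C₂`. -/
def IsRUB {m n L : ℕ} (A : Matrix (Fin m) (Fin n) ℝ →ₗ[ℝ] (Fin L → ℝ))
    (q : ℝ) (r : ℕ) (C₁ C₂ : ℝ) : Prop :=
  ∀ X : Matrix (Fin m) (Fin n) ℝ, X ≠ 0 → X.rank ≤ r →
    C₁ * schattenNorm 2 X ^ q ≤ lqNorm q (A X) ^ q / L ∧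
      lqNorm q (A X) ^ q / L ≤ C₂ * schattenNorm 2 X ^ q

/-- `Y` is a best rank-`r` approximation of `X` (in the Frobenius norm, i.e. the Schatten 2-norm):
it has rank at most `r` and minimizes the distance to `X` among all such matrices. -/
def IsBestRankApprox {m n : ℕ} (r : ℕ) (X Y : Matrix (Fin m) (Fin n) ℝ) : Prop :=
  Y.rank ≤ r ∧ ∀ Z : Matrix (Fin m) (Fin n) ℝ, Z.rank ≤ r →
    schattenNorm 2 (X - Y) ≤ schattenNorm 2 (X - Z)

/-- `Xhat` is a solution of: minimize `‖A(Y) - b‖_q^q` over all `m × n` matrices `Y` subject to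
`‖Y‖_{S_p} = 1`. -/
def IsLeastqSolution {m n L : ℕ} (A : Matrix (Fin m) (Fin n) ℝ →ₗ[ℝ] (Fin L → ℝ))
    (b : Fin L → ℝ) (p q : ℝ) (Xhat : Matrix (Fin m) (Fin n) ℝ) : Prop :=
  schattenNorm p Xhat = 1 ∧ ∀ Y : Matrix (Fin m) (Fin n) ℝ, schattenNorm p Y = 1 →
    lqNorm q (A Xhat - b) ^ q ≤ lqNorm q (A Y - b) ^ q

open Module

/-! Put `H = Xhat - X`, and let `a` and `t` be the `p`-th powers of the `ℓ₂` norm of its first `r +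
s` singular values and of the suitably scaled `ℓ_p` norm of those with index at least `r`. Three
facts are combined. (1) Minimality of `Xhat` against the feasible point `X` bounds the measurements
of `H` by the noise. (2) Cut the singular value decomposition of `H` into a head of `r + s` terms
and blocks of length `s`. Restricted uniform boundedness on each piece bounds `a` by noise plus `β₁
* t` (`IsRUB.head_le`). (3) Equality of the Schatten norms of `X` and `Xhat` gives `t ≤ a + 2T`,
with `T` the scaled tail of `X` (`sum_singularValues_tail_le_head`). Since `β₁ < 1` these can be
solved for `t`, and the Frobenius norm of `H` is at most `a + t` in `p`-th power (`le_of_tail_le`).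

The deep ingredient is behind (3): the concave Mirsky inequality `∑ |σ_j(A)^p - σ_j(B)^p| ≤ ∑ σ_j(A
- B)^p`. It is proved by passing from `B` to `A` through the rank-one terms of the singular value
decomposition of `A - B`. For a rank-one step the singular values interlace and move by at most the
size of the perturbation in `ℓ₁`. Interlacing makes the gaps between them disjoint intervals, and
concavity of `t ^ p` turns the `ℓ₁` bound into the `p`-th power bound. The `ℓ₁` bound comes from the
self-adjoint dilation. -/

theorem OrthonormalBasis.norm_sq_eq_sum_inner_sq {E ι : Type*} [NormedAddCommGroup E] [InnerProductSpace ℝ E] [Fintype ι]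
    (b : OrthonormalBasis ι ℝ E) (x : E) : ‖x‖ ^ 2 = ∑ i, inner ℝ (b i) x ^ 2 := by
  rw [← b.sum_sq_norm_inner_right x]
  simp

/-! ### Eigenvalues of symmetric operators: min-max, monotonicity, reversal -/

namespace LinearMap.IsSymmetric

variable {E : Type*} [NormedAddCommGroup E] [InnerProductSpace ℝ E] [FiniteDimensional ℝ E]

theorem inner_apply_self_eq_sum {T : E →ₗ[ℝ] E} (hT : T.IsSymmetric) {n : ℕ}
    (hn : finrank ℝ E = n) (x : E) :
    inner ℝ (T x) x = ∑ i, hT.eigenvalues hn i * inner ℝ (hT.eigenvectorBasis hn i) x ^ 2 := by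
  rw [← (hT.eigenvectorBasis hn).sum_inner_mul_inner (T x) x]
  refine Finset.sum_congr rfl fun i _ => ?_
  rw [hT x, apply_eigenvectorBasis, inner_smul_right, real_inner_comm x]
  simp only [RCLike.ofReal_real_eq_id, id_eq]
  ring

/-- One half of the Courant-Fischer principle. -/
theorem le_eigenvalues_of_subspace {T : E →ₗ[ℝ] E} (hT : T.IsSymmetric) {n : ℕ}
    (hn : finrank ℝ E = n) (i : Fin n) (V : Submodule ℝ E) (hV : (i : ℕ) < finrank ℝ V) (c : ℝ)
    (h : ∀ x ∈ V, c * ‖x‖ ^ 2 ≤ inner ℝ (T x) x) : c ≤ hT.eigenvalues hn i := by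
  set b := hT.eigenvectorBasis hn with hb
  let f : V →ₗ[ℝ] (Fin i → ℝ) :=
    (LinearMap.pi fun j : Fin i => (innerₛₗ ℝ (b ⟨j, j.2.trans i.2⟩))) ∘ₗ V.subtype
  -- By dimension count, `V` contains a nonzero vector orthogonal to the first `i` eigenvectors.
  have hf : LinearMap.ker f ≠ ⊥ := LinearMap.ker_ne_bot_of_finrank_lt (by simpa using hV)
  obtain ⟨x, hx, hx0⟩ := Submodule.exists_mem_ne_zero_of_ne_bot hf
  have hzero : ∀ j : Fin n, j < i → inner ℝ (b j) (x : E) = 0 := fun j hj => by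
    have := congrFun (LinearMap.mem_ker.1 hx) ⟨j, hj⟩
    simpa [f] using this
  have h1 := h x x.2
  have hpos : 0 < ‖(x : E)‖ ^ 2 := by
    have : (x : E) ≠ 0 := by simpa using hx0
    positivity
  have h2 : inner ℝ (T x) (x : E) ≤ hT.eigenvalues hn i * ‖(x : E)‖ ^ 2 := by
    rw [hT.inner_apply_self_eq_sum hn, b.norm_sq_eq_sum_inner_sq, Finset.mul_sum]
    refine Finset.sum_le_sum fun j _ => ?_
    rcases lt_or_ge j i with hj | hj
    · rw [← hb, hzero j hj]; simp
    · exact mul_le_mul_of_nonneg_right (hT.eigenvalues_antitone hn hj) (sq_nonneg _)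
  exact le_of_mul_le_mul_right (h1.trans h2) hpos

/-- The other half of the Courant-Fischer principle. -/
theorem exists_subspace_eigenvalues_le {T : E →ₗ[ℝ] E} (hT : T.IsSymmetric) {n : ℕ}
    (hn : finrank ℝ E = n) (i : Fin n) :
    ∃ V : Submodule ℝ E, (i : ℕ) < finrank ℝ V ∧
      (∀ x ∈ V, hT.eigenvalues hn i * ‖x‖ ^ 2 ≤ inner ℝ (T x) x) ∧
      ∀ x ∈ V, ∀ j, i < j → inner ℝ (hT.eigenvectorBasis hn j) x = 0 := by
  set b := hT.eigenvectorBasis hn with hb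
  let f : E →ₗ[ℝ] ({j : Fin n // i < j} → ℝ) :=
    LinearMap.pi fun j => (innerₛₗ ℝ (b j))
  have hzero : ∀ x ∈ LinearMap.ker f, ∀ j, i < j → inner ℝ (b j) x = 0 := fun x hx j hj => by
    have := congrFun (LinearMap.mem_ker.1 hx) ⟨j, hj⟩
    simpa [f] using this
  refine ⟨LinearMap.ker f, ?_, fun x hx => ?_, hzero⟩
  · have h1 := f.finrank_range_add_finrank_ker
    have h2 : finrank ℝ (LinearMap.range f) ≤ n - 1 - i := by
      refine (Submodule.finrank_le _).trans ?_
      rw [Module.finrank_fintype_fun_eq_card, Fintype.card_subtype, ← Fin.card_Ioi]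
      refine Finset.card_le_card fun j hj => ?_
      simpa using hj
    have := i.2
    omega
  · rw [hT.inner_apply_self_eq_sum hn, b.norm_sq_eq_sum_inner_sq, Finset.mul_sum]
    refine Finset.sum_le_sum fun j _ => ?_
    rcases le_or_gt j i with hj | hj
    · exact mul_le_mul_of_nonneg_right (hT.eigenvalues_antitone hn hj) (sq_nonneg _)
    · rw [← hb, hzero x hx j hj]; simp

theorem eigenvalues_mono {S T : E →ₗ[ℝ] E} (hS : S.IsSymmetric) (hT : T.IsSymmetric) {n : ℕ}
    (hn : finrank ℝ E = n) (h : ∀ x, inner ℝ (S x) x ≤ inner ℝ (T x) x) (i : Fin n) :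
    hS.eigenvalues hn i ≤ hT.eigenvalues hn i := by
  obtain ⟨V, hV, h1, -⟩ := hS.exists_subspace_eigenvalues_le hn i
  exact hT.le_eigenvalues_of_subspace hn i V hV _ fun x hx => (h1 x hx).trans (h x)

theorem sum_eigenvalues {T : E →ₗ[ℝ] E} (hT : T.IsSymmetric) {n : ℕ} (hn : finrank ℝ E = n) :
    ∑ i, hT.eigenvalues hn i = LinearMap.trace ℝ E T := by
  subst hn
  have := hT.trace_eq_sum_eigenvalues rfl
  simpa using this.symm

/-- The min-max subspaces for `-T` at `j` and for `T` at the reversed index have dimensions adding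
up to more than `n`, so they meet, which gives `≤` at every index. Both sides have the same sum, the
trace, so every inequality is an equality. -/
theorem eigenvalues_rev {T : E →ₗ[ℝ] E} (hT : T.IsSymmetric) (hT' : (-T).IsSymmetric) {n : ℕ}
    (hn : finrank ℝ E = n) (i : Fin n) :
    hT.eigenvalues hn i.rev = - hT'.eigenvalues hn i := by
  have key : ∀ j ∈ Finset.univ, hT.eigenvalues hn (Fin.rev j) ≤ - hT'.eigenvalues hn j := by
    intro j _
    obtain ⟨V, hV, h1, -⟩ := hT'.exists_subspace_eigenvalues_le hn j
    obtain ⟨W, hW, h2, -⟩ := hT.exists_subspace_eigenvalues_le hn (Fin.rev j)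
    have h3 := Submodule.finrank_sup_add_finrank_inf_eq V W
    have h4 := Submodule.finrank_le (V ⊔ W)
    have h5 : 0 < finrank ℝ (V ⊓ W : Submodule ℝ E) := by
      have := Fin.val_rev j
      have := j.2
      omega
    obtain ⟨x, hx, hx0⟩ := Submodule.exists_mem_ne_zero_of_ne_bot
      (Submodule.one_le_finrank_iff.1 h5)
    have h6 := h1 x hx.1
    have h7 := h2 x hx.2
    have hpos : 0 < ‖x‖ ^ 2 := by positivity
    rw [LinearMap.neg_apply, inner_neg_left] at h6
    refine le_of_mul_le_mul_right ?_ hpos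
    linarith
  have hsum : ∑ j, hT.eigenvalues hn (Fin.rev j) = ∑ j, - hT'.eigenvalues hn j := by
    rw [Finset.sum_neg_distrib, sum_eigenvalues, map_neg, neg_neg, ← hT.sum_eigenvalues hn]
    exact Equiv.sum_comp Fin.revPerm (hT.eigenvalues hn)
  exact (Finset.sum_eq_sum_iff_of_le key).1 hsum i (Finset.mem_univ i)

end LinearMap.IsSymmetric

/-! ### Singular values and truncations of the singular value decomposition -/

namespace LinearMap

theorem finrank_inf_ker_ge {E F : Type*} [AddCommGroup E] [Module ℝ E] [FiniteDimensional ℝ E]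
    [AddCommGroup F] [Module ℝ F] (T : E →ₗ[ℝ] F) (V : Submodule ℝ E) :
    finrank ℝ V ≤ finrank ℝ (V ⊓ ker T : Submodule ℝ E) + finrank ℝ (range T) := by
  have h3 := Submodule.finrank_sup_add_finrank_inf_eq V (ker T)
  have h4 := Submodule.finrank_le (V ⊔ ker T)
  have h5 := T.finrank_range_add_finrank_ker
  omega

variable {E F : Type*} [NormedAddCommGroup E] [InnerProductSpace ℝ E] [FiniteDimensional ℝ E]
  [NormedAddCommGroup F] [InnerProductSpace ℝ F] [FiniteDimensional ℝ F]

theorem inner_adjoint_comp_self (T : E →ₗ[ℝ] F) (x : E) :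
    inner ℝ ((adjoint T ∘ₗ T) x) x = ‖T x‖ ^ 2 := by
  rw [comp_apply, adjoint_inner_left, real_inner_self_eq_norm_sq]

theorem le_singularValues_of_subspace (T : E →ₗ[ℝ] F) (i : ℕ) (V : Submodule ℝ E)
    (hV : i < finrank ℝ V) (c : ℝ) (h : ∀ x ∈ V, c * ‖x‖ ≤ ‖T x‖) : c ≤ T.singularValues i := by
  have hi : i < finrank ℝ E := hV.trans_le (Submodule.finrank_le V)
  rcases lt_or_ge c 0 with hc | hc
  · exact hc.le.trans (T.singularValues_nonneg i)
  rw [T.singularValues_of_lt rfl hi]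
  refine Real.le_sqrt_of_sq_le (T.isSymmetric_adjoint_comp_self.le_eigenvalues_of_subspace rfl
    ⟨i, hi⟩ V hV _ fun x hx => ?_)
  rw [inner_adjoint_comp_self, ← mul_pow]
  exact pow_le_pow_left₀ (by positivity) (h x hx) 2

/-- The right singular vectors of `T`. -/
noncomputable def rightSingularBasis (T : E →ₗ[ℝ] F) :
    OrthonormalBasis (Fin (finrank ℝ E)) ℝ E :=
  T.isSymmetric_adjoint_comp_self.eigenvectorBasis rfl

theorem exists_subspace_singularValues_le (T : E →ₗ[ℝ] F) (i : ℕ) (hi : i < finrank ℝ E) :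
    ∃ V : Submodule ℝ E, i < finrank ℝ V ∧ (∀ x ∈ V, T.singularValues i * ‖x‖ ≤ ‖T x‖) ∧
      ∀ x ∈ V, ∀ j : Fin (finrank ℝ E), i < j → inner ℝ (T.rightSingularBasis j) x = 0 := by
  obtain ⟨V, hV, h1, h2⟩ :=
    T.isSymmetric_adjoint_comp_self.exists_subspace_eigenvalues_le rfl ⟨i, hi⟩
  refine ⟨V, hV, fun x hx => ?_, fun x hx j hj => h2 x hx j hj⟩
  have := h1 x hx
  rw [inner_adjoint_comp_self, ← T.sq_singularValues_of_lt, ← mul_pow] at this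
  exact le_of_sq_le_sq this (norm_nonneg _)

theorem inner_apply_rightSingularBasis (T : E →ₗ[ℝ] F) (i j : Fin (finrank ℝ E)) :
    inner ℝ (T (T.rightSingularBasis i)) (T (T.rightSingularBasis j)) =
      if i = j then T.singularValues i ^ 2 else 0 := by
  rw [← adjoint_inner_left, ← comp_apply, rightSingularBasis, IsSymmetric.apply_eigenvectorBasis,
    ← T.sq_singularValues_fin rfl, inner_smul_left, OrthonormalBasis.inner_eq_ite]
  simp

theorem norm_apply_rightSingularBasis (T : E →ₗ[ℝ] F) (i : Fin (finrank ℝ E)) :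
    ‖T (T.rightSingularBasis i)‖ = T.singularValues i := by
  have h := T.inner_apply_rightSingularBasis i i
  rw [real_inner_self_eq_norm_sq, if_pos rfl] at h
  exact (sq_eq_sq₀ (norm_nonneg _) (T.singularValues_nonneg _)).1 h

/-- Weyl's inequality for a perturbation of rank at most `r`. -/
theorem singularValues_add_le_of_finrank_range (A B : E →ₗ[ℝ] F) {r : ℕ}
    (h : finrank ℝ (range (A - B)) ≤ r) (i : ℕ) :
    A.singularValues (i + r) ≤ B.singularValues i := by
  rcases lt_or_ge (i + r) (finrank ℝ E) with hi | hi
  · obtain ⟨V, hV, h1, -⟩ := A.exists_subspace_singularValues_le (i + r) hi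
    refine B.le_singularValues_of_subspace i (V ⊓ ker (A - B)) ?_ _ fun x hx => ?_
    · have := (A - B).finrank_inf_ker_ge V
      omega
    · have h2 : A x = B x := by
        have := mem_ker.1 hx.2
        rwa [sub_apply, sub_eq_zero] at this
      rw [← h2]
      exact h1 x hx.1
  · rw [A.singularValues_of_finrank_le hi]
    exact B.singularValues_nonneg i

theorem singularValues_neg (A : E →ₗ[ℝ] F) : (-A).singularValues = A.singularValues := by
  have key : ∀ (B : E →ₗ[ℝ] F) i, B.singularValues i ≤ (-B).singularValues i := by
    intro B i
    rcases lt_or_ge i (finrank ℝ E) with hi | hi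
    · obtain ⟨V, hV, h1, -⟩ := B.exists_subspace_singularValues_le i hi
      exact le_singularValues_of_subspace _ i V hV _ fun x hx => by simpa using h1 x hx
    · rw [B.singularValues_of_finrank_le hi]
      exact singularValues_nonneg _ i
  ext i
  refine le_antisymm ?_ (key A i)
  simpa using key (-A) i

/-- The map `x ↦ ∑ i, f i * ⟪v i, x⟫ • T (v i)`, where `v` are the right singular vectors of `T`. -/
noncomputable def singularMultiplier (T : E →ₗ[ℝ] F) (f : ℕ → ℝ) : E →ₗ[ℝ] F :=
  ∑ i : Fin (finrank ℝ E), (f i) •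
    (innerₛₗ ℝ (T.rightSingularBasis i)).smulRight (T (T.rightSingularBasis i))

theorem singularMultiplier_apply (T : E →ₗ[ℝ] F) (f : ℕ → ℝ) (x : E) :
    T.singularMultiplier f x = ∑ i : Fin (finrank ℝ E),
      (f i * inner ℝ (T.rightSingularBasis i) x) • T (T.rightSingularBasis i) := by
  simp [singularMultiplier, LinearMap.sum_apply, smul_smul]

theorem singularMultiplier_one (T : E →ₗ[ℝ] F) : T.singularMultiplier 1 = T := by
  ext x
  rw [singularMultiplier_apply]
  conv_rhs => rw [← T.rightSingularBasis.sum_repr' x]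
  simp

theorem singularMultiplier_add (T : E →ₗ[ℝ] F) (f g : ℕ → ℝ) :
    T.singularMultiplier (f + g) = T.singularMultiplier f + T.singularMultiplier g := by
  simp [singularMultiplier, add_smul, Finset.sum_add_distrib]

theorem singularMultiplier_congr (T : E →ₗ[ℝ] F) {f g : ℕ → ℝ} (h : ∀ i < finrank ℝ E, f i = g i) :
    T.singularMultiplier f = T.singularMultiplier g :=
  Finset.sum_congr rfl fun i _ => by rw [h i i.2]

theorem inner_singularMultiplier (T : E →ₗ[ℝ] F) (f g : ℕ → ℝ) (x y : E) :
    inner ℝ (T.singularMultiplier f x) (T.singularMultiplier g y) =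
      ∑ i : Fin (finrank ℝ E), f i * g i * T.singularValues i ^ 2 *
        (inner ℝ (T.rightSingularBasis i) x * inner ℝ (T.rightSingularBasis i) y) := by
  simp only [singularMultiplier_apply, sum_inner, inner_sum, inner_smul_left, inner_smul_right,
    inner_apply_rightSingularBasis]
  refine Finset.sum_congr rfl fun i _ => ?_
  simp
  ring

theorem singularMultiplier_rightSingularBasis (T : E →ₗ[ℝ] F) (f : ℕ → ℝ)
    (i : Fin (finrank ℝ E)) :
    T.singularMultiplier f (T.rightSingularBasis i) = f i • T (T.rightSingularBasis i) := by
  rw [singularMultiplier_apply]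
  simp [OrthonormalBasis.inner_eq_ite]

theorem sum_singularValues_sq (T : E →ₗ[ℝ] F) (b : OrthonormalBasis (Fin (finrank ℝ E)) ℝ E) :
    ∑ i : Fin (finrank ℝ E), T.singularValues i ^ 2 = ∑ i, ‖T (b i)‖ ^ 2 := by
  simp only [T.sq_singularValues_fin rfl]
  rw [IsSymmetric.sum_eigenvalues, LinearMap.trace_eq_sum_inner _ b]
  refine Finset.sum_congr rfl fun i _ => ?_
  rw [real_inner_comm, inner_adjoint_comp_self]

/-- The sum of squares is a trace, computable in any orthonormal basis. Using that of `T` avoids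
identifying the individual singular values of the multiplier. -/
theorem sum_singularValues_singularMultiplier_sq (T : E →ₗ[ℝ] F) (f : ℕ → ℝ) :
    ∑ i : Fin (finrank ℝ E), (T.singularMultiplier f).singularValues i ^ 2 =
      ∑ i : Fin (finrank ℝ E), (f i * T.singularValues i) ^ 2 := by
  rw [sum_singularValues_sq _ T.rightSingularBasis]
  refine Finset.sum_congr rfl fun i _ => ?_
  rw [singularMultiplier_rightSingularBasis, norm_smul, norm_apply_rightSingularBasis, mul_pow,
    mul_pow, Real.norm_eq_abs, sq_abs]

theorem finrank_range_singularMultiplier_le (T : E →ₗ[ℝ] F) (f : ℕ → ℝ) (s : Finset ℕ)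
    (hf : ∀ i ∉ s, f i = 0) : finrank ℝ (range (T.singularMultiplier f)) ≤ s.card := by
  classical
  let w : ℕ → F := fun i => if h : i < finrank ℝ E then T (T.rightSingularBasis ⟨i, h⟩) else 0
  have hle : range (T.singularMultiplier f) ≤ Submodule.span ℝ ((s.image w : Finset F) : Set F) := by
    rintro _ ⟨x, rfl⟩
    rw [singularMultiplier_apply]
    refine Submodule.sum_mem _ fun i _ => ?_
    by_cases hi : (i : ℕ) ∈ s
    · refine Submodule.smul_mem _ _ (Submodule.subset_span ?_)
      rw [Finset.mem_coe, Finset.mem_image]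
      exact ⟨i, hi, by simp [w]⟩
    · simp [hf i hi]
  exact (Submodule.finrank_mono hle).trans ((finrank_span_finset_le_card _).trans
    Finset.card_image_le)

end LinearMap

/-! ### Self-adjoint dilation and rank-one perturbations -/

namespace LinearMap

theorem isSymmetric_innerₛₗ_smulRight {E : Type*} [NormedAddCommGroup E] [InnerProductSpace ℝ E]
    (p : E) :
    ((innerₛₗ ℝ p).smulRight p).IsSymmetric := by
  intro x y
  simp [inner_smul_left, inner_smul_right, real_inner_comm p, mul_comm]

theorem inner_innerₛₗ_smulRight_nonneg {E : Type*} [NormedAddCommGroup E]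
    [InnerProductSpace ℝ E] (p x : E) :
    0 ≤ inner ℝ ((innerₛₗ ℝ p).smulRight p x) x := by
  simpa [inner_smul_left] using mul_self_nonneg (inner ℝ p x)

variable {E F : Type*} [NormedAddCommGroup E] [InnerProductSpace ℝ E] [FiniteDimensional ℝ E]
  [NormedAddCommGroup F] [InnerProductSpace ℝ F] [FiniteDimensional ℝ F]

/-- The self-adjoint dilation `(y, x) ↦ (A x, A† y)` of `A`. -/
noncomputable def dilation (A : E →ₗ[ℝ] F) : WithLp 2 (F × E) →ₗ[ℝ] WithLp 2 (F × E) :=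
  (WithLp.linearEquiv 2 ℝ (F × E)).symm.toLinearMap ∘ₗ
    ((A ∘ₗ snd ℝ F E).prod (adjoint A ∘ₗ fst ℝ F E)) ∘ₗ
      (WithLp.linearEquiv 2 ℝ (F × E)).toLinearMap

theorem inner_dilation (A : E →ₗ[ℝ] F) (z z' : WithLp 2 (F × E)) :
    inner ℝ (dilation A z) z' = inner ℝ (A z.snd) z'.fst + inner ℝ (A z'.snd) z.fst := by
  rw [WithLp.prod_inner_apply]
  change inner ℝ (A z.snd) z'.fst + inner ℝ (adjoint A z.fst) z'.snd = _
  rw [adjoint_inner_left, real_inner_comm z.fst]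

theorem isSymmetric_dilation (A : E →ₗ[ℝ] F) : (dilation A).IsSymmetric := by
  intro z z'
  rw [inner_dilation, real_inner_comm (dilation A z') z, inner_dilation, add_comm]

theorem dilation_neg (A : E →ₗ[ℝ] F) : dilation (-A) = -dilation A := by
  refine LinearMap.ext fun z => (WithLp.equiv 2 (F × E)).injective (Prod.ext ?_ ?_)
  · rfl
  · change adjoint (-A) z.fst = -adjoint A z.fst
    simp

theorem finrank_withLp_prod :
    finrank ℝ (WithLp 2 (F × E)) = finrank ℝ F + finrank ℝ E := by
  rw [(WithLp.linearEquiv 2 ℝ (F × E)).finrank_eq, Module.finrank_prod]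

/-- On a min-max subspace with `c > 0` one has `c (‖y‖² + ‖x‖²) ≤ 2⟪A x, y⟫`. Hence `x = 0` forces
`y = 0`, so projecting to `x` loses no dimension, and `2‖x‖‖y‖ ≤ ‖x‖² + ‖y‖²` yields `c‖x‖ ≤ ‖A x‖`.
-/
theorem eigenvalues_dilation_le (A : E →ₗ[ℝ] F)
    (j : Fin (finrank ℝ F + finrank ℝ E)) :
    (isSymmetric_dilation A).eigenvalues finrank_withLp_prod j ≤ A.singularValues j := by
  set c := (isSymmetric_dilation A).eigenvalues finrank_withLp_prod j with hc
  rcases le_or_gt c 0 with h0 | h0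
  · exact h0.trans (A.singularValues_nonneg _)
  obtain ⟨V, hV, h1, -⟩ :=
    (isSymmetric_dilation A).exists_subspace_eigenvalues_le finrank_withLp_prod j
  have key : ∀ z ∈ V, c * (‖z.fst‖ ^ 2 + ‖z.snd‖ ^ 2) ≤ 2 * inner ℝ (A z.snd) z.fst := by
    intro z hz
    have := h1 z hz
    rw [WithLp.prod_norm_sq_eq_of_L2, inner_dilation] at this
    linarith
  let g : V →ₗ[ℝ] E := snd ℝ F E ∘ₗ (WithLp.linearEquiv 2 ℝ (F × E)).toLinearMap ∘ₗ V.subtype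
  have hgapp : ∀ z : V, g z = (z : WithLp 2 (F × E)).snd := fun _ => rfl
  have hzero : ∀ z ∈ V, z.snd = 0 → z.fst = 0 := by
    intro z hz hs
    have := key z hz
    rw [hs] at this
    simp only [norm_zero, map_zero, inner_zero_left] at this
    have h2 : ‖z.fst‖ ^ 2 ≤ 0 := by nlinarith
    simpa using h2
  have hg : Function.Injective g := by
    rw [injective_iff_map_eq_zero]
    intro z hz
    have h2 := hzero z z.2 hz
    refine Subtype.ext ((WithLp.equiv 2 (F × E)).injective (Prod.ext h2 hz))
  refine A.le_singularValues_of_subspace j (range g) ?_ c ?_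
  · rwa [finrank_range_of_inj hg]
  · rintro _ ⟨z, rfl⟩
    rw [hgapp]
    have h2 := key z z.2
    set x := (z : WithLp 2 (F × E)).snd with hx
    set y := (z : WithLp 2 (F × E)).fst with hy
    have h3 := real_inner_le_norm (A x) y
    rcases (norm_nonneg y).eq_or_lt with hy0 | hy0
    · rw [← hy0] at h2 h3
      have h4 : ‖x‖ ^ 2 ≤ 0 := by nlinarith
      have h5 : x = 0 := by simpa using h4
      simp [h5]
    · refine le_of_mul_le_mul_right ?_ hy0
      nlinarith [mul_nonneg h0.le (sq_nonneg (‖x‖ - ‖y‖))]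

/-- The test subspace is the graph of the polar partial isometry of `A` over the leading right
singular vectors. If the singular value vanishes, `F × 0` serves, since the form is zero there. -/
theorem le_eigenvalues_dilation (A : E →ₗ[ℝ] F) (j : Fin (finrank ℝ F + finrank ℝ E))
    (hF : (j : ℕ) < finrank ℝ F) (hE : (j : ℕ) < finrank ℝ E) :
    A.singularValues j ≤ (isSymmetric_dilation A).eigenvalues finrank_withLp_prod j := by
  rcases (A.singularValues_nonneg j).eq_or_lt with h0 | h0
  · rw [← h0]
    let g : F →ₗ[ℝ] WithLp 2 (F × E) :=
      (WithLp.linearEquiv 2 ℝ (F × E)).symm.toLinearMap ∘ₗ inl ℝ F E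
    have hg : Function.Injective g :=
      (WithLp.linearEquiv 2 ℝ (F × E)).symm.injective.comp inl_injective
    refine (isSymmetric_dilation A).le_eigenvalues_of_subspace _ j (range g) ?_ 0 ?_
    · rwa [finrank_range_of_inj hg]
    · rintro _ ⟨y, rfl⟩
      rw [inner_dilation]
      have : (g y).snd = 0 := rfl
      simp [this]
  · obtain ⟨V, hV, -, h2⟩ := A.exists_subspace_singularValues_le j hE
    -- With `0⁻¹ = 0` this multiplier normalizes the nonzero `A v_i` and kills the kernel
    -- directions.
    let f : ℕ → ℝ := fun i => (A.singularValues i)⁻¹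
    let g : V →ₗ[ℝ] WithLp 2 (F × E) :=
      (WithLp.linearEquiv 2 ℝ (F × E)).symm.toLinearMap ∘ₗ
        ((A.singularMultiplier f).prod LinearMap.id) ∘ₗ V.subtype
    have hg2 : ∀ x : V, (g x).snd = x := fun _ => rfl
    have hg1 : ∀ x : V, (g x).fst = A.singularMultiplier f x := fun _ => rfl
    have hg : Function.Injective g := by
      intro x y hxy
      apply Subtype.ext
      rw [← hg2 x, ← hg2 y, hxy]
    refine (isSymmetric_dilation A).le_eigenvalues_of_subspace _ j (range g) ?_ _ ?_
    · rwa [finrank_range_of_inj hg]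
    · rintro _ ⟨x, rfl⟩
      rw [inner_dilation, WithLp.prod_norm_sq_eq_of_L2, hg1, hg2]
      have e1 : inner ℝ (A x) (A.singularMultiplier f x) = ∑ i : Fin (finrank ℝ E),
          A.singularValues i * inner ℝ (A.rightSingularBasis i) (x : E) ^ 2 := by
        conv_lhs => enter [2]; rw [← A.singularMultiplier_one]
        rw [inner_singularMultiplier]
        refine Finset.sum_congr rfl fun i _ => ?_
        rcases eq_or_ne (A.singularValues i) 0 with h | h
        · simp [h]
        · simp only [f, Pi.one_apply]
          field_simp
      have e2 : ‖A.singularMultiplier f x‖ ^ 2 ≤ ∑ i : Fin (finrank ℝ E),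
          inner ℝ (A.rightSingularBasis i) (x : E) ^ 2 := by
        rw [← real_inner_self_eq_norm_sq, inner_singularMultiplier]
        refine Finset.sum_le_sum fun i _ => ?_
        rcases eq_or_ne (A.singularValues i) 0 with h | h
        · simp [h, sq_nonneg]
        · simp only [f]
          field_simp
          exact le_rfl
      have e3 : A.singularValues j * ∑ i : Fin (finrank ℝ E),
          inner ℝ (A.rightSingularBasis i) (x : E) ^ 2 ≤ ∑ i : Fin (finrank ℝ E),
          A.singularValues i * inner ℝ (A.rightSingularBasis i) (x : E) ^ 2 := by
        rw [Finset.mul_sum]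
        refine Finset.sum_le_sum fun i _ => ?_
        rcases le_or_gt (i : ℕ) j with hij | hij
        · exact mul_le_mul_of_nonneg_right (A.singularValues_antitone hij) (sq_nonneg _)
        · rw [h2 x x.2 i hij]; simp
      rw [e1, A.rightSingularBasis.norm_sq_eq_sum_inner_sq (x : E)]
      nlinarith [mul_le_mul_of_nonneg_left e2 h0.le]

/-- Each singular value occurs in the dilation's spectrum with both signs, among the top `l` and the
bottom `l` eigenvalues. These index sets are disjoint, whence the factor `2`. -/
theorem sum_abs_singularValues_sub_le_of_eigenvalues (A B : E →ₗ[ℝ] F) {l : ℕ}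
    (hF : l ≤ finrank ℝ F) (hE : l ≤ finrank ℝ E) :
    2 * ∑ j ∈ Finset.range l, |A.singularValues j - B.singularValues j| ≤
      ∑ j, |(isSymmetric_dilation A).eigenvalues finrank_withLp_prod j -
        (isSymmetric_dilation B).eigenvalues finrank_withLp_prod j| := by
  set N := finrank ℝ F + finrank ℝ E with hN
  have top : ∀ (C : E →ₗ[ℝ] F) (j : Fin N), (j : ℕ) < l →
      (isSymmetric_dilation C).eigenvalues finrank_withLp_prod j = C.singularValues j :=
    fun C j hj => le_antisymm (eigenvalues_dilation_le C j)
      (le_eigenvalues_dilation C j (hj.trans_le hF) (hj.trans_le hE))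
  have bot : ∀ (C : E →ₗ[ℝ] F) (j : Fin N), (j : ℕ) < l →
      (isSymmetric_dilation C).eigenvalues finrank_withLp_prod j.rev = - C.singularValues j := by
    intro C j hj
    have h1 := (isSymmetric_dilation C).eigenvalues_rev
      (by rw [← dilation_neg]; exact isSymmetric_dilation (-C)) finrank_withLp_prod j
    rw [h1, ← C.singularValues_neg, ← top (-C) j hj]
    simp only [dilation_neg]
  set φ : Fin N → ℝ := fun j => |(isSymmetric_dilation A).eigenvalues finrank_withLp_prod j -
        (isSymmetric_dilation B).eigenvalues finrank_withLp_prod j| with hφ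
  let e : Fin l → Fin N := Fin.castLE (by omega)
  have he : Function.Injective e := Fin.castLE_injective _
  have hd : Disjoint (Finset.univ.map ⟨e, he⟩)
      (Finset.univ.map ⟨fun i => (e i).rev, Fin.rev_injective.comp he⟩) := by
    rw [Finset.disjoint_left]
    intro x hx hx'
    simp only [Finset.mem_map, Finset.mem_univ, true_and, Function.Embedding.coeFn_mk] at hx hx'
    obtain ⟨a, rfl⟩ := hx
    obtain ⟨b, hb⟩ := hx'
    have := congrArg Fin.val hb
    simp only [Fin.val_rev, e, Fin.val_castLE] at this
    omega
  calc 2 * ∑ j ∈ Finset.range l, |A.singularValues j - B.singularValues j|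
      = ∑ i : Fin l, φ (e i) + ∑ i : Fin l, φ (e i).rev := by
        rw [two_mul, Finset.sum_range]
        congr 1
        · refine Finset.sum_congr rfl fun i _ => ?_
          simp only [hφ]
          rw [top A (e i) i.2, top B (e i) i.2]; rfl
        · refine Finset.sum_congr rfl fun i _ => ?_
          simp only [hφ]
          rw [bot A (e i) i.2, bot B (e i) i.2, neg_sub_neg, abs_sub_comm]; rfl
    _ = ∑ j ∈ (Finset.univ.map ⟨e, he⟩).disjUnion
          (Finset.univ.map ⟨fun i => (e i).rev, Fin.rev_injective.comp he⟩) hd, φ j := by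
        rw [Finset.sum_disjUnion, Finset.sum_map, Finset.sum_map]; rfl
    _ ≤ ∑ j, φ j := Finset.sum_le_sum_of_subset_of_nonneg (Finset.subset_univ _)
        fun _ _ _ => abs_nonneg _

theorem trace_innerₛₗ_smulRight (p : E) :
    LinearMap.trace ℝ E ((innerₛₗ ℝ p).smulRight p) = ‖p‖ ^ 2 := by
  rw [LinearMap.trace_eq_sum_inner _ (stdOrthonormalBasis ℝ E),
    (stdOrthonormalBasis ℝ E).norm_sq_eq_sum_inner_sq]
  refine Finset.sum_congr rfl fun i _ => ?_
  simp [inner_smul_right, real_inner_comm p, sq]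

/-- Both operators lie below the common sum `C`, so `|s - t| ≤ (c - s) + (c - t)` eigenvalue by
eigenvalue. The total gaps are the traces of the rank-one terms. -/
theorem sum_abs_eigenvalues_sub_le {S T : E →ₗ[ℝ] E} (hS : S.IsSymmetric) (hT : T.IsSymmetric)
    {n : ℕ} (hn : finrank ℝ E = n) (p q : E)
    (h : S + (innerₛₗ ℝ p).smulRight p = T + (innerₛₗ ℝ q).smulRight q) :
    ∑ j, |hS.eigenvalues hn j - hT.eigenvalues hn j| ≤ ‖p‖ ^ 2 + ‖q‖ ^ 2 := by
  have hC := hS.add (isSymmetric_innerₛₗ_smulRight p)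
  have h1 : ∀ j, hS.eigenvalues hn j ≤ hC.eigenvalues hn j :=
    hS.eigenvalues_mono hC hn fun x => by
      rw [add_apply, inner_add_left]
      linarith [inner_innerₛₗ_smulRight_nonneg p x]
  have h2 : ∀ j, hT.eigenvalues hn j ≤ hC.eigenvalues hn j :=
    hT.eigenvalues_mono hC hn fun x => by
      rw [h, add_apply, inner_add_left]
      linarith [inner_innerₛₗ_smulRight_nonneg q x]
  have e1 : ∑ j, hC.eigenvalues hn j = ∑ j, hS.eigenvalues hn j + ‖p‖ ^ 2 := by
    rw [hC.sum_eigenvalues, hS.sum_eigenvalues, map_add, trace_innerₛₗ_smulRight]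
  have e2 : ∑ j, hC.eigenvalues hn j = ∑ j, hT.eigenvalues hn j + ‖q‖ ^ 2 := by
    rw [hC.sum_eigenvalues, hT.sum_eigenvalues, h, map_add, trace_innerₛₗ_smulRight]
  calc ∑ j, |hS.eigenvalues hn j - hT.eigenvalues hn j|
      ≤ ∑ j, ((hC.eigenvalues hn j - hS.eigenvalues hn j) +
          (hC.eigenvalues hn j - hT.eigenvalues hn j)) := by
        refine Finset.sum_le_sum fun j _ => ?_
        rw [abs_le]
        constructor <;> linarith [h1 j, h2 j]
    _ = ‖p‖ ^ 2 + ‖q‖ ^ 2 := by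
        rw [Finset.sum_add_distrib, Finset.sum_sub_distrib, Finset.sum_sub_distrib]
        linarith

/-- In the dilation a rank-one change becomes a difference of two positive rank-one operators, built
on `(α w, γ v)` and `(-α w, γ v)`. -/
theorem sum_abs_singularValues_sub_le (A B : E →ₗ[ℝ] F) (v : E) (w : F)
    (h : A = B + (innerₛₗ ℝ v).smulRight w) {l : ℕ}
    (hF : l ≤ finrank ℝ F) (hE : l ≤ finrank ℝ E) :
    ∑ j ∈ Finset.range l, |A.singularValues j - B.singularValues j| ≤ ‖v‖ * ‖w‖ := by
  rcases eq_or_ne v 0 with rfl | hv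
  · have : A = B := by rw [h]; ext; simp
    simp [this]
  rcases eq_or_ne w 0 with rfl | hw
  · have : A = B := by rw [h]; ext; simp
    simp [this]
  have hv' : 0 < ‖v‖ := norm_pos_iff.2 hv
  have hw' : 0 < ‖w‖ := norm_pos_iff.2 hw
  -- The first equation makes the cross terms reproduce the perturbation. The other two balance the
  -- components, so that `p` and `q` both have squared norm `‖v‖ * ‖w‖`.
  obtain ⟨α, γ, h1, h2, h3⟩ : ∃ α γ : ℝ, 2 * α * γ = 1 ∧ α ^ 2 * ‖w‖ ^ 2 = ‖v‖ * ‖w‖ / 2 ∧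
      γ ^ 2 * ‖v‖ ^ 2 = ‖v‖ * ‖w‖ / 2 := by
    have hs : 0 < √(‖v‖ / (2 * ‖w‖)) := Real.sqrt_pos.2 (by positivity)
    refine ⟨√(‖v‖ / (2 * ‖w‖)), (2 * √(‖v‖ / (2 * ‖w‖)))⁻¹, by field_simp, ?_, ?_⟩
    · rw [Real.sq_sqrt (by positivity)]; field_simp
    · rw [inv_pow, mul_pow, Real.sq_sqrt (by positivity)]; field_simp
  let p : WithLp 2 (F × E) := WithLp.toLp 2 (α • w, γ • v)
  let q : WithLp 2 (F × E) := WithLp.toLp 2 (-(α • w), γ • v)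
  have hp : ‖p‖ ^ 2 = ‖v‖ * ‖w‖ := by
    rw [WithLp.prod_norm_sq_eq_of_L2]
    change ‖α • w‖ ^ 2 + ‖γ • v‖ ^ 2 = _
    simp only [norm_smul, mul_pow, Real.norm_eq_abs, sq_abs, h2, h3]
    ring
  have hq : ‖q‖ ^ 2 = ‖v‖ * ‖w‖ := by
    rw [WithLp.prod_norm_sq_eq_of_L2]
    change ‖-(α • w)‖ ^ 2 + ‖γ • v‖ ^ 2 = _
    simp only [norm_neg, norm_smul, mul_pow, Real.norm_eq_abs, sq_abs, h2, h3]
    ring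
  have hp_inner : ∀ z, inner ℝ p z = α * inner ℝ w z.fst + γ * inner ℝ v z.snd := by
    intro z
    change inner ℝ (α • w) z.fst + inner ℝ (γ • v) z.snd = _
    simp [inner_smul_left]
  have hq_inner : ∀ z, inner ℝ q z = -(α * inner ℝ w z.fst) + γ * inner ℝ v z.snd := by
    intro z
    change inner ℝ (-(α • w)) z.fst + inner ℝ (γ • v) z.snd = _
    simp [inner_smul_left]
  have hadj : ∀ y, adjoint A y = adjoint B y + inner ℝ w y • v := by
    intro y
    refine ext_inner_right ℝ fun x => ?_
    rw [inner_add_left, adjoint_inner_left, adjoint_inner_left, h, inner_smul_left]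
    simp [inner_add_right, inner_smul_right, real_inner_comm y]
    ring
  have hAB : dilation A + (innerₛₗ ℝ q).smulRight q = dilation B + (innerₛₗ ℝ p).smulRight p := by
    refine LinearMap.ext fun z => (WithLp.equiv 2 (F × E)).injective (Prod.ext ?_ ?_)
    · change A z.snd + inner ℝ q z • (-(α • w)) = B z.snd + inner ℝ p z • (α • w)
      rw [hp_inner, hq_inner, h, add_apply, smulRight_apply, innerₛₗ_apply_apply, add_assoc]
      congr 1
      rw [← one_smul ℝ (inner ℝ v z.snd • w), ← h1]
      module
    · change adjoint A z.fst + inner ℝ q z • (γ • v) = adjoint B z.fst + inner ℝ p z • (γ • v)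
      rw [hp_inner, hq_inner, hadj, add_assoc]
      congr 1
      rw [← one_smul ℝ (inner ℝ w z.fst • v), ← h1]
      module
  have k1 := sum_abs_singularValues_sub_le_of_eigenvalues A B hF hE
  have k2 := sum_abs_eigenvalues_sub_le (isSymmetric_dilation A) (isSymmetric_dilation B)
    finrank_withLp_prod q p hAB
  linarith

end LinearMap

/-! ### Concavity of `t ^ p` along disjoint intervals -/

/-- Increments of a concave function decrease: `m` and `s + d` are complementary convex combinations
of `s` and `m + d`. -/
theorem Real.add_rpow_sub_rpow_antitone {p : ℝ} (hp : 0 ≤ p) (hp1 : p ≤ 1) {s m d : ℝ}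
    (hs : 0 ≤ s) (hsm : s ≤ m) (hd : 0 ≤ d) :
    (m + d) ^ p - m ^ p ≤ (s + d) ^ p - s ^ p := by
  rcases hsm.eq_or_lt with rfl | hlt
  · exact le_rfl
  have hD : 0 < m + d - s := by linarith
  have hf := (Real.concaveOn_rpow hp hp1).2
  have hs' : s ∈ Set.Ici (0 : ℝ) := hs
  have hm' : m + d ∈ Set.Ici (0 : ℝ) := by
    rw [Set.mem_Ici]
    linarith
  have ha : 0 ≤ d / (m + d - s) := by positivity
  have hb : 0 ≤ (m - s) / (m + d - s) := div_nonneg (by linarith) hD.le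
  have hab : d / (m + d - s) + (m - s) / (m + d - s) = 1 := by
    field_simp
    ring
  have h1 := hf hs' hm' ha hb hab
  have h2 := hf hs' hm' hb ha (by rw [add_comm, hab])
  simp only [smul_eq_mul] at h1 h2
  have e1 : d / (m + d - s) * s + (m - s) / (m + d - s) * (m + d) = m := by
    field_simp
    ring
  have e2 : (m - s) / (m + d - s) * s + d / (m + d - s) * (m + d) = s + d := by
    field_simp
    ring
  rw [e1] at h1
  rw [e2] at h2
  have h3 : (d / (m + d - s) + (m - s) / (m + d - s)) * (s ^ p + (m + d) ^ p) =
      s ^ p + (m + d) ^ p := by rw [hab, one_mul]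
  linarith

/-- Slide the disjoint intervals `[m j, M j]` down until they are packed from `0`. By concavity each
increment only grows, and the packed increments telescope. -/
theorem Real.sum_rpow_sub_rpow_le_of_disjoint {p : ℝ} (hp : 0 < p) (hp1 : p ≤ 1) (l : ℕ) :
    ∀ (M m : ℕ → ℝ), (∀ j, 0 ≤ m j) → (∀ j, m j ≤ M j) → (∀ j, M (j + 1) ≤ m j) →
      ∑ j ∈ Finset.range l, (M j - m j) ≤ M 0 ∧
      ∑ j ∈ Finset.range l, (M j ^ p - m j ^ p) ≤ (∑ j ∈ Finset.range l, (M j - m j)) ^ p := by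
  induction l with
  | zero =>
    intro M m h0 h1 _
    simpa [Real.zero_rpow hp.ne'] using (h0 0).trans (h1 0)
  | succ l ih =>
    intro M m h0 h1 h2
    obtain ⟨k1, k2⟩ := ih (fun j => M (j + 1)) (fun j => m (j + 1)) (fun j => h0 _)
      (fun j => h1 _) (fun j => h2 _)
    rw [Finset.sum_range_succ', Finset.sum_range_succ']
    have hS : 0 ≤ ∑ j ∈ Finset.range l, (M (j + 1) - m (j + 1)) :=
      Finset.sum_nonneg fun j _ => sub_nonneg.2 (h1 _)
    have h3 := h2 0
    -- The lower intervals have total length at most `M 1 ≤ m 0`, so the top one can be moved down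
    -- to start at that length.
    have h4 := Real.add_rpow_sub_rpow_antitone hp.le hp1 hS (k1.trans h3) (sub_nonneg.2 (h1 0))
    rw [add_sub_cancel] at h4
    refine ⟨by linarith, by linarith⟩

theorem Real.sum_abs_rpow_sub_rpow_le_of_interlace {p : ℝ} (hp : 0 < p) (hp1 : p ≤ 1) (l : ℕ)
    (a b : ℕ → ℝ) (ha0 : ∀ j, 0 ≤ a j) (hb0 : ∀ j, 0 ≤ b j) (ha : Antitone a) (hb : Antitone b)
    (hab : ∀ j, a (j + 1) ≤ b j) (hba : ∀ j, b (j + 1) ≤ a j) :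
    ∑ j ∈ Finset.range l, |a j ^ p - b j ^ p| ≤ (∑ j ∈ Finset.range l, |a j - b j|) ^ p := by
  have h := (Real.sum_rpow_sub_rpow_le_of_disjoint hp hp1 l (fun j => max (a j) (b j))
    (fun j => min (a j) (b j)) (fun j => le_min (ha0 j) (hb0 j)) (fun j => min_le_max)
    (fun j => max_le (le_min (ha j.le_succ) (hab j)) (le_min (hba j) (hb j.le_succ)))).2
  have e1 : ∀ j, max (a j) (b j) - min (a j) (b j) = |a j - b j| :=
    fun j => (max_sub_min_eq_abs' _ _)
  have e2 : ∀ j, max (a j) (b j) ^ p - min (a j) (b j) ^ p = |a j ^ p - b j ^ p| := by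
    intro j
    rcases le_total (a j) (b j) with hj | hj
    · rw [max_eq_right hj, min_eq_left hj, abs_sub_comm, abs_of_nonneg]
      exact sub_nonneg.2 (Real.rpow_le_rpow (ha0 j) hj hp.le)
    · rw [max_eq_left hj, min_eq_right hj, abs_of_nonneg]
      exact sub_nonneg.2 (Real.rpow_le_rpow (hb0 j) hj hp.le)
  simpa only [e1, e2] using h

/-! ### The concave Mirsky inequality -/

namespace LinearMap

theorem finrank_range_innerₛₗ_smulRight_le {E F : Type*} [NormedAddCommGroup E] [InnerProductSpace ℝ E]
    [AddCommGroup F] [Module ℝ F] (v : E) (w : F) :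
    finrank ℝ (range ((innerₛₗ ℝ v).smulRight w)) ≤ 1 := by
  have hle : range ((innerₛₗ ℝ v).smulRight w) ≤ Submodule.span ℝ {w} := by
    rintro _ ⟨x, rfl⟩
    exact Submodule.smul_mem _ _ (Submodule.mem_span_singleton_self w)
  exact (Submodule.finrank_mono hle).trans ((finrank_span_le_card {w}).trans (by simp))

variable {E F : Type*} [NormedAddCommGroup E] [InnerProductSpace ℝ E] [FiniteDimensional ℝ E]
  [NormedAddCommGroup F] [InnerProductSpace ℝ F] [FiniteDimensional ℝ F]

theorem sum_abs_singularValues_rpow_sub_le_of_rankOne {p : ℝ} (hp : 0 < p) (hp1 : p ≤ 1)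
    (A B : E →ₗ[ℝ] F) (v : E) (w : F)
    (h : A = B + (innerₛₗ ℝ v).smulRight w) {l : ℕ}
    (hF : l ≤ finrank ℝ F) (hE : l ≤ finrank ℝ E) :
    ∑ j ∈ Finset.range l, |A.singularValues j ^ p - B.singularValues j ^ p| ≤
      (‖v‖ * ‖w‖) ^ p := by
  have h1 : finrank ℝ (range (A - B)) ≤ 1 := by
    rw [h, add_sub_cancel_left]
    exact finrank_range_innerₛₗ_smulRight_le v w
  have h2 : finrank ℝ (range (B - A)) ≤ 1 := by
    rwa [← neg_sub A B, range_neg]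
  refine (Real.sum_abs_rpow_sub_rpow_le_of_interlace hp hp1 l _ _ A.singularValues_nonneg
    B.singularValues_nonneg A.singularValues_antitone B.singularValues_antitone
    (A.singularValues_add_le_of_finrank_range B h1)
    (B.singularValues_add_le_of_finrank_range A h2)).trans ?_
  exact Real.rpow_le_rpow (Finset.sum_nonneg fun _ _ => abs_nonneg _)
    (sum_abs_singularValues_sub_le A B v w h hF hE) hp.le

/-- The concave Mirsky inequality for the function `t ↦ t ^ p`, `0 < p ≤ 1`. -/
theorem sum_abs_singularValues_rpow_sub_le {p : ℝ} (hp : 0 < p) (hp1 : p ≤ 1)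
    (A B : E →ₗ[ℝ] F) {l : ℕ} (hF : l ≤ finrank ℝ F) (hE : l ≤ finrank ℝ E) :
    ∑ j ∈ Finset.range l, |A.singularValues j ^ p - B.singularValues j ^ p| ≤
      ∑ i ∈ Finset.range (finrank ℝ E), (A - B).singularValues i ^ p := by
  classical
  set T := A - B with hT
  -- Multiplying by `f k` keeps the first `k` singular terms of `A - B`. Step `k` then adds a
  -- rank-one term of size `σ_k`, at cost `σ_k ^ p`.
  let f : ℕ → ℕ → ℝ := fun k i => if i < k then 1 else 0
  have key : ∀ k ≤ finrank ℝ E, ∑ j ∈ Finset.range l,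
      |(B + T.singularMultiplier (f k)).singularValues j ^ p - B.singularValues j ^ p| ≤
        ∑ i ∈ Finset.range k, T.singularValues i ^ p := by
    intro k
    induction k with
    | zero =>
      intro _
      have : T.singularMultiplier (f 0) = 0 := by
        ext x
        simp [singularMultiplier_apply, f]
      simp [this]
    | succ k ih =>
      intro hk
      have h1 := ih (by omega)
      have hstep : B + T.singularMultiplier (f (k + 1)) = (B + T.singularMultiplier (f k)) +
          (innerₛₗ ℝ (T.rightSingularBasis ⟨k, hk⟩)).smulRight
            (T (T.rightSingularBasis ⟨k, hk⟩)) := by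
        have hf : f (k + 1) = f k + Pi.single k 1 := by
          ext i
          rcases lt_trichotomy i k with h | h | h
          · simp [f, h, h.ne, Nat.lt_succ_of_lt h]
          · simp [f, h]
          · have h' : ¬ i < k + 1 := by omega
            simp [f, h', h.ne', h.not_gt]
        rw [hf, singularMultiplier_add, add_assoc]
        congr 2
        ext x
        rw [singularMultiplier_apply, Finset.sum_eq_single ⟨k, hk⟩]
        · simp
        · intro i _ hi
          have : (i : ℕ) ≠ k := fun h => hi (Fin.ext h)
          simp [this]
        · simp
      have h2 := sum_abs_singularValues_rpow_sub_le_of_rankOne hp hp1 _ _ _ _ hstep hF hE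
      rw [norm_apply_rightSingularBasis, OrthonormalBasis.norm_eq_one, one_mul] at h2
      rw [Finset.sum_range_succ]
      refine le_trans ?_ (add_le_add h1 h2)
      rw [← Finset.sum_add_distrib]
      refine Finset.sum_le_sum fun j _ => ?_
      generalize (B + T.singularMultiplier (f (k + 1))).singularValues j ^ p = x
      generalize (B + T.singularMultiplier (f k)).singularValues j ^ p = y
      rw [add_comm]
      exact abs_sub_le x y _
  have h := key _ le_rfl
  have hone : T.singularMultiplier (f (finrank ℝ E)) = T := by
    conv_rhs => rw [← T.singularMultiplier_one]
    exact T.singularMultiplier_congr fun i hi => by simp [f, hi]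
  rwa [hone, hT, add_sub_cancel] at h

end LinearMap

/-! ### Block estimates for decreasing sequences -/

namespace Real

theorem rpow_sum_le_sum_rpow {ι : Type*} (t : Finset ι) (f : ι → ℝ) (hf : ∀ i, 0 ≤ f i)
    {p : ℝ} (hp : 0 < p) (hp1 : p ≤ 1) : (∑ i ∈ t, f i) ^ p ≤ ∑ i ∈ t, f i ^ p := by
  classical
  induction t using Finset.induction_on with
  | empty => simp [Real.zero_rpow hp.ne']
  | insert a t ha ih =>
    rw [Finset.sum_insert ha, Finset.sum_insert ha]
    exact (Real.rpow_add_le_add_rpow (hf a) (Finset.sum_nonneg fun i _ => hf i) hp.le hp1).trans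
      (add_le_add le_rfl ih)

theorem sum_rpow_le_rpow_sum {ι : Type*} (t : Finset ι) (f : ι → ℝ) (hf : ∀ i, 0 ≤ f i)
    {P : ℝ} (hP : 1 ≤ P) : ∑ i ∈ t, f i ^ P ≤ (∑ i ∈ t, f i) ^ P := by
  have hP0 : 0 < P := by linarith
  have h := rpow_sum_le_sum_rpow t (fun i => f i ^ P) (fun i => Real.rpow_nonneg (hf i) _)
    (inv_pos.2 hP0) (inv_le_one_of_one_le₀ hP)
  simp only [Real.rpow_rpow_inv (hf _) hP0.ne'] at h
  have hs : 0 ≤ ∑ i ∈ t, f i ^ P := Finset.sum_nonneg fun i _ => Real.rpow_nonneg (hf i) _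
  calc ∑ i ∈ t, f i ^ P = ((∑ i ∈ t, f i ^ P) ^ P⁻¹) ^ P := (Real.rpow_inv_rpow hs hP0.ne').symm
    _ ≤ _ := Real.rpow_le_rpow (Real.rpow_nonneg hs _) h hP0.le

theorem rpow_rpow_two_div {x p : ℝ} (hx : 0 ≤ x) (hp : 0 < p) : (x ^ p) ^ (2 / p) = x ^ 2 := by
  rw [← Real.rpow_mul hx, mul_div_cancel₀ _ hp.ne', Real.rpow_two]

/-- Every entry of a block is at most the `p`-mean of the preceding block. -/
theorem sum_sq_block_rpow_le {h : ℕ → ℝ} (h0 : ∀ i, 0 ≤ h i) (hanti : Antitone h) {p : ℝ}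
    (hp : 0 < p) {s : ℕ} (hs : 0 < s) (a : ℕ) :
    (∑ i ∈ Finset.range s, h (a + s + i) ^ 2) ^ (p / 2) ≤
      (s : ℝ) ^ (-(1 - p / 2)) * ∑ i ∈ Finset.range s, h (a + i) ^ p := by
  set S := ∑ i ∈ Finset.range s, h (a + i) ^ p with hS
  have hs' : (0 : ℝ) < s := Nat.cast_pos.2 hs
  have hS0 : 0 ≤ S := Finset.sum_nonneg fun i _ => Real.rpow_nonneg (h0 _) _
  have h1 : ∀ i, h (a + s + i) ^ p ≤ S / s := by
    intro i
    rw [le_div_iff₀ hs', mul_comm, ← nsmul_eq_mul]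
    have hcard := Finset.card_nsmul_le_sum (Finset.range s) (fun j => h (a + j) ^ p)
      (h (a + s + i) ^ p) fun j hj => by
        refine Real.rpow_le_rpow (h0 _) (hanti ?_) hp.le
        have := Finset.mem_range.1 hj
        omega
    rwa [Finset.card_range] at hcard
  have h2 : ∑ i ∈ Finset.range s, h (a + s + i) ^ 2 ≤ s * (S / s) ^ (2 / p) := by
    have := Finset.sum_le_card_nsmul (Finset.range s) (fun i => h (a + s + i) ^ 2)
      ((S / s) ^ (2 / p)) fun i _ => by
        rw [← rpow_rpow_two_div (h0 _) hp]
        exact Real.rpow_le_rpow (Real.rpow_nonneg (h0 _) _) (h1 i) (by positivity)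
    simpa using this
  calc (∑ i ∈ Finset.range s, h (a + s + i) ^ 2) ^ (p / 2)
      ≤ (s * (S / s) ^ (2 / p)) ^ (p / 2) :=
        Real.rpow_le_rpow (Finset.sum_nonneg fun i _ => sq_nonneg _) h2 (by positivity)
    _ = (s : ℝ) ^ (p / 2) * (S / s) := by
        rw [Real.mul_rpow hs'.le (by positivity), ← Real.rpow_mul (by positivity)]
        congr 1
        rw [show 2 / p * (p / 2) = 1 by field_simp, Real.rpow_one]
    _ = (s : ℝ) ^ (-(1 - p / 2)) * S := by
        rw [neg_sub, Real.rpow_sub_one hs'.ne']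
        ring

theorem sum_range_blocks (g : ℕ → ℝ) (s K : ℕ) :
    ∑ k ∈ Finset.range K, ∑ i ∈ Finset.range s, g (k * s + i) = ∑ i ∈ Finset.range (K * s), g i := by
  induction K with
  | zero => simp
  | succ K ih => rw [Finset.sum_range_succ, ih, Nat.succ_mul, Finset.sum_range_add]

/-- Raise the single-block estimate to the power `q / p ≥ 1`. Superadditivity of that power then
merges the blocks. -/
theorem sum_blocks_rpow_half_le {h : ℕ → ℝ} (h0 : ∀ i, 0 ≤ h i) (hanti : Antitone h) {p q : ℝ}
    (hp : 0 < p) (hpq : p ≤ q) {s : ℕ} (hs : 0 < s) (r K : ℕ) :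
    ∑ k ∈ Finset.range K, (∑ i ∈ Finset.range s, h (r + s + k * s + i) ^ 2) ^ (q / 2) ≤
      ((s : ℝ) ^ (-(1 - p / 2)) * ∑ i ∈ Finset.range (K * s), h (r + i) ^ p) ^ (q / p) := by
  have hqp : 1 ≤ q / p := (one_le_div hp).2 hpq
  have hb : ∀ k, (∑ i ∈ Finset.range s, h (r + s + k * s + i) ^ 2) ^ (q / 2) ≤
      ((s : ℝ) ^ (-(1 - p / 2)) * ∑ i ∈ Finset.range s, h (r + (k * s + i)) ^ p) ^ (q / p) := by
    intro k
    have h1 := sum_sq_block_rpow_le h0 hanti hp hs (r + k * s)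
    have hE : 0 ≤ ∑ i ∈ Finset.range s, h (r + k * s + s + i) ^ 2 :=
      Finset.sum_nonneg fun i _ => sq_nonneg _
    have h2 := Real.rpow_le_rpow (Real.rpow_nonneg hE _) h1 (by linarith : 0 ≤ q / p)
    rw [← Real.rpow_mul hE, show p / 2 * (q / p) = q / 2 by field_simp] at h2
    convert h2 using 6 <;> ring_nf
  refine (Finset.sum_le_sum fun k _ => hb k).trans ?_
  refine (sum_rpow_le_rpow_sum _ _ (fun k => mul_nonneg (by positivity)
    (Finset.sum_nonneg fun i _ => Real.rpow_nonneg (h0 _) _)) hqp).trans (le_of_eq ?_)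
  rw [← Finset.mul_sum, sum_range_blocks (fun i => h (r + i) ^ p)]

theorem sum_blocks_sq_rpow_le {h : ℕ → ℝ} (h0 : ∀ i, 0 ≤ h i) (hanti : Antitone h) {p : ℝ}
    (hp : 0 < p) (hp1 : p ≤ 1) {s : ℕ} (hs : 0 < s) (r K : ℕ) :
    (∑ i ∈ Finset.range (K * s), h (r + s + i) ^ 2) ^ (p / 2) ≤
      (s : ℝ) ^ (-(1 - p / 2)) * ∑ i ∈ Finset.range (K * s), h (r + i) ^ p := by
  have h1 := sum_blocks_rpow_half_le h0 hanti hp le_rfl hs r K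
  rw [div_self hp.ne', Real.rpow_one] at h1
  refine le_trans ?_ h1
  rw [← sum_range_blocks (fun i => h (r + s + i) ^ 2)]
  simp only [← add_assoc]
  exact rpow_sum_le_sum_rpow _ _ (fun k => Finset.sum_nonneg fun i _ => sq_nonneg _)
    (by positivity) (by linarith)

theorem sum_rpow_le_mul_sum_sq_rpow {h : ℕ → ℝ} (h0 : ∀ i, 0 ≤ h i) {p : ℝ} (hp : 0 < p)
    (hp1 : p ≤ 1) {r : ℕ} (hr : 0 < r) :
    ∑ i ∈ Finset.range r, h i ^ p ≤
      (r : ℝ) ^ (1 - p / 2) * (∑ i ∈ Finset.range r, h i ^ 2) ^ (p / 2) := by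
  have hr' : (0 : ℝ) < r := Nat.cast_pos.2 hr
  have h1 : 1 ≤ 2 / p := by rw [le_div_iff₀ hp]; linarith
  have h2 := Real.rpow_sum_le_const_mul_sum_rpow_of_nonneg (Finset.range r)
    (f := fun i => h i ^ p) h1 fun i _ => Real.rpow_nonneg (h0 i) _
  simp only [rpow_rpow_two_div (h0 _) hp, Finset.card_range] at h2
  have hS : 0 ≤ ∑ i ∈ Finset.range r, h i ^ p := Finset.sum_nonneg fun i _ =>
    Real.rpow_nonneg (h0 i) _
  have h3 := Real.rpow_le_rpow (Real.rpow_nonneg hS _) h2 (by positivity : 0 ≤ p / 2)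
  rw [← Real.rpow_mul hS, show 2 / p * (p / 2) = 1 by field_simp, Real.rpow_one,
    Real.mul_rpow (by positivity) (Finset.sum_nonneg fun i _ => sq_nonneg _),
    ← Real.rpow_mul hr'.le, show (2 / p - 1) * (p / 2) = 1 - p / 2 by field_simp] at h3
  exact h3

end Real

/-! ### Schatten norms, truncated matrices and tails -/

section Norms

variable {m n L : ℕ}

theorem finrank_range_toEuclideanLin (X : Matrix (Fin m) (Fin n) ℝ) :
    finrank ℝ (LinearMap.range (Matrix.toEuclideanLin X)) = X.rank := by
  rw [X.rank_eq_finrank_range_toLin (PiLp.basisFun 2 ℝ (Fin m)) (PiLp.basisFun 2 ℝ (Fin n)),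
    ← Matrix.toLpLin_eq_toLin]

theorem singularValues_toEuclideanLin_eq_zero (X : Matrix (Fin m) (Fin n) ℝ) {j : ℕ}
    (hj : min m n ≤ j) : (Matrix.toEuclideanLin X).singularValues j = 0 := by
  rw [LinearMap.singularValues_eq_zero_iff_le_finrank_range, finrank_range_toEuclideanLin]
  exact (le_min (by simpa using X.rank_le_height) (by simpa using X.rank_le_width)).trans hj

theorem sum_range_eq_of_eq_zero {g : ℕ → ℝ} {a b : ℕ} (hab : a ≤ b) (hg : ∀ j, a ≤ j → g j = 0) :
    ∑ j ∈ Finset.range a, g j = ∑ j ∈ Finset.range b, g j :=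
  Finset.sum_subset (Finset.range_mono hab) fun j _ hj => hg j (by simpa using hj)

/-- Padding with zero singular values leaves the range free, so block lengths need not match `min m
n`. -/
theorem schattenNorm_rpow {p : ℝ} (hp : 0 < p) (X : Matrix (Fin m) (Fin n) ℝ) {N : ℕ}
    (hN : min m n ≤ N) : schattenNorm p X ^ p =
      ∑ j ∈ Finset.range N, (Matrix.toEuclideanLin X).singularValues j ^ p := by
  rw [schattenNorm, one_div, Real.rpow_inv_rpow _ hp.ne']
  · exact sum_range_eq_of_eq_zero hN fun j hj => by
      rw [singularValues_toEuclideanLin_eq_zero X hj, Real.zero_rpow hp.ne']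
  · exact Finset.sum_nonneg fun j _ => Real.rpow_nonneg (LinearMap.singularValues_nonneg _ _) _

theorem schattenNorm_two_rpow (X : Matrix (Fin m) (Fin n) ℝ) {N : ℕ}
    (hN : min m n ≤ N) (q : ℝ) : schattenNorm 2 X ^ q =
      (∑ j ∈ Finset.range N, (Matrix.toEuclideanLin X).singularValues j ^ 2) ^ (q / 2) := by
  have h0 : 0 ≤ schattenNorm 2 X := Real.rpow_nonneg
    (Finset.sum_nonneg fun j _ => Real.rpow_nonneg (LinearMap.singularValues_nonneg _ _) _) _
  have h := schattenNorm_rpow two_pos X hN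
  simp only [Real.rpow_two] at h
  rw [← h, ← Real.rpow_two, ← Real.rpow_mul h0]
  congr 1
  ring

theorem lqNorm_rpow {q : ℝ} (hq : 0 < q) (z : Fin L → ℝ) : lqNorm q z ^ q = ∑ i, |z i| ^ q := by
  rw [lqNorm, one_div, Real.rpow_inv_rpow _ hq.ne']
  exact Finset.sum_nonneg fun j _ => Real.rpow_nonneg (abs_nonneg _) _

theorem sum_abs_sum_rpow_le {ι : Type*} (t : Finset ι) (y : ι → Fin L → ℝ) {q : ℝ} (hq : 0 < q)
    (hq1 : q ≤ 1) :
    ∑ i, |(∑ k ∈ t, y k) i| ^ q ≤ ∑ k ∈ t, ∑ i, |y k i| ^ q := by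
  rw [Finset.sum_comm]
  refine Finset.sum_le_sum fun i _ => ?_
  rw [Finset.sum_apply]
  exact (Real.rpow_le_rpow (abs_nonneg _) (Finset.abs_sum_le_sum_abs _ _) hq.le).trans
    (Real.rpow_sum_le_sum_rpow t _ (fun k => abs_nonneg _) hq hq1)

theorem sum_abs_add_rpow_le (y z : Fin L → ℝ) {q : ℝ} (hq : 0 < q) (hq1 : q ≤ 1) :
    ∑ i, |(y + z) i| ^ q ≤ ∑ i, |y i| ^ q + ∑ i, |z i| ^ q := by
  simpa using sum_abs_sum_rpow_le Finset.univ ![y, z] hq hq1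

/-- The part of the singular value decomposition of `X` with indices in `t`. -/
noncomputable def singularPart (X : Matrix (Fin m) (Fin n) ℝ) (t : Finset ℕ) :
    Matrix (Fin m) (Fin n) ℝ :=
  Matrix.toEuclideanLin.symm
    ((Matrix.toEuclideanLin X).singularMultiplier (fun i => if i ∈ t then 1 else 0))

theorem rank_singularPart_le (X : Matrix (Fin m) (Fin n) ℝ) (t : Finset ℕ) :
    (singularPart X t).rank ≤ t.card := by
  rw [← finrank_range_toEuclideanLin, singularPart, LinearEquiv.apply_symm_apply]
  exact LinearMap.finrank_range_singularMultiplier_le _ _ t fun i hi => if_neg hi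

theorem singularPart_of_subset (X : Matrix (Fin m) (Fin n) ℝ) {t : Finset ℕ}
    (ht : Finset.range n ⊆ t) : singularPart X t = X := by
  rw [singularPart, LinearEquiv.symm_apply_eq]
  conv_rhs => rw [← (Matrix.toEuclideanLin X).singularMultiplier_one]
  refine LinearMap.singularMultiplier_congr _ fun i hi => ?_
  rw [finrank_euclideanSpace_fin] at hi
  simp [ht (Finset.mem_range.2 hi)]

theorem singularPart_union (X : Matrix (Fin m) (Fin n) ℝ) {t u : Finset ℕ} (h : Disjoint t u) :
    singularPart X (t ∪ u) = singularPart X t + singularPart X u := by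
  simp only [singularPart]
  rw [← map_add, ← LinearMap.singularMultiplier_add]
  congr 2
  ext i
  have : i ∈ t → i ∉ u := fun hi => Finset.disjoint_left.1 h hi
  by_cases h1 : i ∈ t <;> by_cases h2 : i ∈ u <;> simp_all

theorem schattenNorm_two_singularPart_rpow (X : Matrix (Fin m) (Fin n) ℝ) (t : Finset ℕ) (q : ℝ) :
    schattenNorm 2 (singularPart X t) ^ q =
      (∑ j ∈ t, (Matrix.toEuclideanLin X).singularValues j ^ 2) ^ (q / 2) := by
  rw [schattenNorm_two_rpow _ (min_le_right m n)]
  congr 1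
  have h := (Matrix.toEuclideanLin X).sum_singularValues_singularMultiplier_sq
    (fun i => if i ∈ t then 1 else 0)
  rw [← Finset.sum_range (fun i => LinearMap.singularValues _ i ^ 2),
    ← Finset.sum_range (fun i => ((if i ∈ t then (1 : ℝ) else 0) *
      (Matrix.toEuclideanLin X).singularValues i) ^ 2), finrank_euclideanSpace_fin] at h
  rw [singularPart, LinearEquiv.apply_symm_apply, h]
  have h2 : ∀ i, ((if i ∈ t then (1 : ℝ) else 0) *
      (Matrix.toEuclideanLin X).singularValues i) ^ 2 =
      if i ∈ t then (Matrix.toEuclideanLin X).singularValues i ^ 2 else 0 := by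
    intro i
    split_ifs <;> simp
  simp only [h2]
  rw [← Finset.sum_filter]
  refine Finset.sum_subset (fun i hi => (Finset.mem_filter.1 hi).2) fun i hi hi' => ?_
  have : n ≤ i := by
    by_contra hlt
    exact hi' (Finset.mem_filter.2 ⟨Finset.mem_range.2 (not_le.1 hlt), hi⟩)
  rw [singularValues_toEuclideanLin_eq_zero X ((min_le_right m n).trans this)]
  simp

theorem IsRUB.apply_singularPart {A : Matrix (Fin m) (Fin n) ℝ →ₗ[ℝ] (Fin L → ℝ)} {q : ℝ} {N : ℕ}
    {C₁ C₂ : ℝ} (hA : IsRUB A q N C₁ C₂) (hq : 0 < q) (X : Matrix (Fin m) (Fin n) ℝ)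
    {t : Finset ℕ} (ht : t.card ≤ N) :
    C₁ * (∑ j ∈ t, (Matrix.toEuclideanLin X).singularValues j ^ 2) ^ (q / 2) ≤
        (∑ i, |A (singularPart X t) i| ^ q) / L ∧
      (∑ i, |A (singularPart X t) i| ^ q) / L ≤
        C₂ * (∑ j ∈ t, (Matrix.toEuclideanLin X).singularValues j ^ 2) ^ (q / 2) := by
  rw [← schattenNorm_two_singularPart_rpow, ← lqNorm_rpow hq]
  -- The boundedness condition covers nonzero matrices only; for a zero part all terms vanish.
  by_cases h0 : singularPart X t = 0
  · rw [schattenNorm_two_rpow _ le_rfl, lqNorm_rpow hq, h0]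
    simp [Real.zero_rpow hq.ne', Real.zero_rpow (half_pos hq).ne']
  · exact hA _ h0 ((rank_singularPart_le X t).trans ht)

/-- The concave Mirsky inequality for matrices. -/
theorem sum_abs_singularValues_rpow_sub_le_schattenNorm {p : ℝ} (hp : 0 < p) (hp1 : p ≤ 1)
    (X Y : Matrix (Fin m) (Fin n) ℝ) (N : ℕ) :
    ∑ j ∈ Finset.range N, |(Matrix.toEuclideanLin X).singularValues j ^ p -
      (Matrix.toEuclideanLin Y).singularValues j ^ p| ≤ schattenNorm p (X - Y) ^ p := by
  have h := LinearMap.sum_abs_singularValues_rpow_sub_le hp hp1 (Matrix.toEuclideanLin X)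
    (Matrix.toEuclideanLin Y) (l := min m n) (by simp) (by simp)
  rw [finrank_euclideanSpace_fin, ← map_sub, ← schattenNorm_rpow hp _ (min_le_right m n)] at h
  refine le_trans ?_ h
  rw [sum_range_eq_of_eq_zero (le_max_left (min m n) N) fun j hj => by
    rw [singularValues_toEuclideanLin_eq_zero X hj, singularValues_toEuclideanLin_eq_zero Y hj,
      sub_self, abs_zero]]
  exact Finset.sum_le_sum_of_subset_of_nonneg (Finset.range_mono (le_max_right _ _))
    fun _ _ _ => abs_nonneg _

/-- The tail of the singular values is bounded by the error of any low-rank approximation. -/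
theorem sum_singularValues_tail_le {p : ℝ} (hp : 0 < p) (X Y : Matrix (Fin m) (Fin n) ℝ) {r : ℕ}
    (hY : Y.rank ≤ r) (N : ℕ) :
    ∑ j ∈ Finset.range N, (Matrix.toEuclideanLin X).singularValues (r + j) ^ p ≤
      schattenNorm p (X - Y) ^ p := by
  rw [schattenNorm_rpow hp _ (le_max_left (min m n) N)]
  refine (Finset.sum_le_sum fun j _ => ?_).trans (Finset.sum_le_sum_of_subset_of_nonneg
    (Finset.range_mono (le_max_right _ _)) fun _ _ _ =>
      Real.rpow_nonneg (LinearMap.singularValues_nonneg _ _) _)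
  refine Real.rpow_le_rpow (LinearMap.singularValues_nonneg _ _) ?_ hp.le
  rw [add_comm]
  refine LinearMap.singularValues_add_le_of_finrank_range _ _ ?_ j
  rwa [← map_sub, sub_sub_cancel, finrank_range_toEuclideanLin]

end Norms

/-! ### Head and tail of the error matrix -/

section Main

variable {m n L : ℕ}

theorem singularPart_eq_add_sum (X : Matrix (Fin m) (Fin n) ℝ) (a s K : ℕ) :
    singularPart X (Finset.range (a + K * s)) = singularPart X (Finset.range a) +
      ∑ k ∈ Finset.range K, singularPart X (Finset.Ico (a + k * s) (a + k * s + s)) := by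
  induction K with
  | zero => simp
  | succ K ih =>
    rw [Finset.sum_range_succ, ← add_assoc, ← ih, ← singularPart_union, Nat.succ_mul, ← add_assoc]
    · congr 1
      ext i
      simp only [Finset.mem_range, Finset.mem_union, Finset.mem_Ico]
      omega
    · rw [Finset.disjoint_left]
      intro i
      simp only [Finset.mem_range, Finset.mem_Ico]
      omega

/-- Under `ℓ_q`-restricted uniform boundedness, the leading singular values of `H` are controlled
by the measurements of `H` and the remaining singular values. -/
theorem IsRUB.head_le {A : Matrix (Fin m) (Fin n) ℝ →ₗ[ℝ] (Fin L → ℝ)} {p q : ℝ} {r s : ℕ}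
    {C₁ C₂ : ℝ} (hA : IsRUB A q (s + r) C₁ C₂) (hp : 0 < p) (hpq : p ≤ q) (hq1 : q ≤ 1)
    (hs : 0 < s) (hL : 0 < L) (hC₂ : 0 ≤ C₂) (H : Matrix (Fin m) (Fin n) ℝ) :
    C₁ * L * (∑ j ∈ Finset.range (r + s),
        (Matrix.toEuclideanLin H).singularValues j ^ 2) ^ (q / 2) ≤
      ∑ i, |A H i| ^ q + C₂ * L * ((s : ℝ) ^ (-(1 - p / 2)) * ∑ j ∈ Finset.range (n * s),
        (Matrix.toEuclideanLin H).singularValues (r + j) ^ p) ^ (q / p) := by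
  have hq : 0 < q := hp.trans_le hpq
  have hL' : (0 : ℝ) < L := Nat.cast_pos.2 hL
  set h := (Matrix.toEuclideanLin H).singularValues with hh
  let Y : ℕ → Matrix (Fin m) (Fin n) ℝ := fun k =>
    singularPart H (Finset.Ico (r + s + k * s) (r + s + k * s + s))
  -- As `s ≥ 1`, `n` blocks of length `s` exhaust all `n` singular directions.
  have hdec : singularPart H (Finset.range (r + s)) = H + ∑ k ∈ Finset.range n, -Y k := by
    have h1 := singularPart_eq_add_sum H (r + s) s n
    rw [singularPart_of_subset H (t := Finset.range (r + s + n * s))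
      (Finset.range_mono (by nlinarith))] at h1
    rw [Finset.sum_neg_distrib, ← sub_eq_add_neg, eq_sub_iff_add_eq]
    exact h1.symm
  have h1 := (hA.apply_singularPart hq H (t := Finset.range (r + s))
    (by rw [Finset.card_range, add_comm])).1
  rw [le_div_iff₀ hL'] at h1
  have h2 : ∀ k, ∑ i, |A (-Y k) i| ^ q ≤
      C₂ * L * (∑ i ∈ Finset.range s, h (r + s + k * s + i) ^ 2) ^ (q / 2) := by
    intro k
    have h3 := (hA.apply_singularPart hq H (t := Finset.Ico (r + s + k * s) (r + s + k * s + s))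
      (by rw [Nat.card_Ico]; omega)).2
    rw [div_le_iff₀ hL', Finset.sum_Ico_eq_sum_range, Nat.add_sub_cancel_left] at h3
    simp only [map_neg, Pi.neg_apply, abs_neg]
    linarith
  have h4 : ∑ i, |A (singularPart H (Finset.range (r + s))) i| ^ q ≤
      ∑ i, |A H i| ^ q + ∑ k ∈ Finset.range n, ∑ i, |A (-Y k) i| ^ q := by
    rw [hdec, map_add, map_sum]
    exact (sum_abs_add_rpow_le _ _ hq hq1).trans
      (add_le_add le_rfl (sum_abs_sum_rpow_le _ _ hq hq1))
  have h5 := Real.sum_blocks_rpow_half_le (LinearMap.singularValues_nonneg _)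
    (Matrix.toEuclideanLin H).singularValues_antitone hp hpq hs r n
  have h6 : ∑ k ∈ Finset.range n, ∑ i, |A (-Y k) i| ^ q ≤
      C₂ * L * ∑ k ∈ Finset.range n,
        (∑ i ∈ Finset.range s, h (r + s + k * s + i) ^ 2) ^ (q / 2) := by
    rw [Finset.mul_sum]
    exact Finset.sum_le_sum fun k _ => h2 k
  have h7 := mul_le_mul_of_nonneg_left h5 (mul_nonneg hC₂ hL'.le)
  linarith

theorem schattenNorm_two_rpow_le {p : ℝ} (hp : 0 < p) (hp1 : p ≤ 1) {s : ℕ} (hs : 0 < s) (r : ℕ)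
    (H : Matrix (Fin m) (Fin n) ℝ) :
    schattenNorm 2 H ^ p ≤ (∑ j ∈ Finset.range (r + s),
        (Matrix.toEuclideanLin H).singularValues j ^ 2) ^ (p / 2) +
      (s : ℝ) ^ (-(1 - p / 2)) * ∑ j ∈ Finset.range (n * s),
        (Matrix.toEuclideanLin H).singularValues (r + j) ^ p := by
  have hN : min m n ≤ r + s + n * s := (min_le_right m n).trans (by nlinarith)
  rw [schattenNorm_two_rpow H hN, Finset.sum_range_add]
  have h1 := Real.rpow_add_le_add_rpow
    (Finset.sum_nonneg fun j (_ : j ∈ Finset.range (r + s)) =>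
      sq_nonneg ((Matrix.toEuclideanLin H).singularValues j))
    (Finset.sum_nonneg fun j (_ : j ∈ Finset.range (n * s)) =>
      sq_nonneg ((Matrix.toEuclideanLin H).singularValues (r + s + j))) (half_pos hp).le
    (by linarith : p / 2 ≤ 1)
  exact h1.trans (add_le_add le_rfl (Real.sum_blocks_sq_rpow_le
    (LinearMap.singularValues_nonneg _) (Matrix.toEuclideanLin H).singularValues_antitone
    hp hp1 hs r n))

/-- The null-space type inequality satisfied by the difference of two matrices whose Schatten
`p`-norms are ordered. -/
theorem sum_singularValues_tail_le_head {p : ℝ} (hp : 0 < p) (hp1 : p ≤ 1)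
    (X Y : Matrix (Fin m) (Fin n) ℝ) (hXY : schattenNorm p Y ^ p ≤ schattenNorm p X ^ p) (r : ℕ)
    {M : ℕ} (hM : min m n ≤ r + M) :
    ∑ j ∈ Finset.range M, (Matrix.toEuclideanLin (Y - X)).singularValues (r + j) ^ p ≤
      ∑ j ∈ Finset.range r, (Matrix.toEuclideanLin (Y - X)).singularValues j ^ p +
        2 * ∑ j ∈ Finset.range M, (Matrix.toEuclideanLin X).singularValues (r + j) ^ p := by
  -- Mirsky is applied to `X` and `X - Y`, whose difference is `Y`. The absolute values are then
  -- dropped with opposite signs on head and tail.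
  have h := sum_abs_singularValues_rpow_sub_le_schattenNorm hp hp1 X (X - Y) (r + M)
  have hneg : (Matrix.toEuclideanLin (X - Y)).singularValues =
      (Matrix.toEuclideanLin (Y - X)).singularValues := by
    rw [← neg_sub Y X, map_neg, LinearMap.singularValues_neg]
  rw [sub_sub_cancel, hneg, Finset.sum_range_add] at h
  have h2 := h.trans hXY
  rw [schattenNorm_rpow hp X hM, Finset.sum_range_add] at h2
  have h3 : ∀ a b : ℕ → ℝ, ∀ t : Finset ℕ, ∑ j ∈ t, a j - ∑ j ∈ t, b j ≤ ∑ j ∈ t, |a j - b j| := by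
    intro a b t
    rw [← Finset.sum_sub_distrib]
    exact Finset.sum_le_sum fun j _ => le_abs_self _
  have h4 := h3 (fun j => (Matrix.toEuclideanLin X).singularValues j ^ p)
    (fun j => (Matrix.toEuclideanLin (Y - X)).singularValues j ^ p) (Finset.range r)
  have h5 := h3 (fun j => (Matrix.toEuclideanLin (Y - X)).singularValues (r + j) ^ p)
    (fun j => (Matrix.toEuclideanLin X).singularValues (r + j) ^ p) (Finset.range M)
  simp only [abs_sub_comm ((Matrix.toEuclideanLin (Y - X)).singularValues (r + _) ^ p)] at h5
  linarith

/-- Test the condition on the leading singular term of `X`. For `L = 0` the quotient is `0` by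
convention, contradicting the lower bound. -/
theorem IsRUB.pos {A : Matrix (Fin m) (Fin n) ℝ →ₗ[ℝ] (Fin L → ℝ)} {q : ℝ} {N : ℕ} {C₁ C₂ : ℝ}
    (hA : IsRUB A q N C₁ C₂) (hq : 0 < q) (hN : 0 < N) (hC₁ : 0 < C₁)
    {X : Matrix (Fin m) (Fin n) ℝ} (hX : X ≠ 0) : 0 < L ∧ C₁ ≤ C₂ := by
  have h0 : 0 < (Matrix.toEuclideanLin X).singularValues 0 := by
    rw [LinearMap.singularValues_pos_iff_lt_finrank_range, Nat.pos_iff_ne_zero, Ne,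
      Submodule.finrank_eq_zero, LinearMap.range_eq_bot]
    simpa using hX
  obtain ⟨h1, h2⟩ := hA.apply_singularPart hq X (t := {0}) (by simpa using Nat.succ_le_of_lt hN)
  rw [Finset.sum_singleton] at h1 h2
  have h3 : 0 < ((Matrix.toEuclideanLin X).singularValues 0 ^ 2) ^ (q / 2) := by positivity
  constructor
  · rw [Nat.pos_iff_ne_zero]
    rintro rfl
    have := mul_pos hC₁ h3
    simp only [Nat.cast_zero, div_zero] at h1
    linarith
  · exact le_of_mul_le_mul_right (h1.trans h2) h3

/-- The power `p / q ≤ 1` is subadditive, so taking it makes the estimate linear in `x`. -/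
theorem rpow_half_le_of_head_le {p q α ε x C₁ C₂ l : ℝ} (hp : 0 < p) (hpq : p ≤ q)
    (hα : 0 ≤ α) (hε : 0 ≤ ε) (hx : 0 ≤ x) (hC₁ : 0 < C₁) (hl : 0 < l) (hC₂ : 0 ≤ C₂)
    (h : C₁ * l * α ^ (q / 2) ≤ ε + C₂ * l * x ^ (q / p)) :
    α ^ (p / 2) ≤ (C₁ * l) ^ (-(p / q)) * ε ^ (p / q) + (C₂ / C₁) ^ (p / q) * x := by
  have hq : 0 < q := hp.trans_le hpq
  have hCl : 0 < C₁ * l := mul_pos hC₁ hl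
  have h1 : α ^ (q / 2) ≤ (C₁ * l)⁻¹ * ε + C₂ / C₁ * x ^ (q / p) := by
    rw [← mul_le_mul_iff_right₀ hCl]
    refine h.trans (le_of_eq ?_)
    field_simp
  have hxq : 0 ≤ x ^ (q / p) := Real.rpow_nonneg hx _
  have h2 := (Real.rpow_le_rpow (Real.rpow_nonneg hα _) h1 (div_pos hp hq).le).trans
    (Real.rpow_add_le_add_rpow (mul_nonneg (inv_pos.2 hCl).le hε)
      (mul_nonneg (div_nonneg hC₂ hC₁.le) hxq) (div_pos hp hq).le ((div_le_one hq).2 hpq))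
  rwa [← Real.rpow_mul hα, show q / 2 * (p / q) = p / 2 by field_simp,
    Real.mul_rpow (inv_pos.2 hCl).le hε, Real.mul_rpow (div_nonneg hC₂ hC₁.le) hxq,
    ← Real.rpow_mul hx, show q / p * (p / q) = 1 by field_simp, Real.rpow_one,
    Real.inv_rpow hCl.le, ← Real.rpow_neg hCl.le] at h2

theorem le_of_tail_le {v a t T D β : ℝ} (hD : 0 ≤ D) (hT : 0 ≤ T) (hβ : 0 < β) (hβ1 : β < 1)
    (ha : a ≤ D + β * t) (ht : t ≤ a + 2 * T) (hv : v ≤ a + t) :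
    v ≤ (2 * (1 + β) ^ 2 * T + (3 + β) * D) / (1 - β) := by
  have h1β : 0 < 1 - β := by linarith
  have ht' : t ≤ (D + 2 * T) / (1 - β) := by
    rw [le_div_iff₀ h1β]
    linarith
  calc v ≤ D + (1 + β) * ((D + 2 * T) / (1 - β)) := by
        have := mul_le_mul_of_nonneg_left ht' (by linarith : 0 ≤ 1 + β)
        linarith
    _ = (2 * (1 + β) * T + 2 * D) / (1 - β) := by
        field_simp
        ring
    -- The preceding constants are sharper; here `1 + β ≤ (1 + β) ^ 2` and `2 ≤ 3 + β` relax them.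
    _ ≤ (2 * (1 + β) ^ 2 * T + (3 + β) * D) / (1 - β) := by
        refine div_le_div_of_nonneg_right (add_le_add ?_ ?_) h1β.le
        · refine mul_le_mul_of_nonneg_right ?_ hT
          nlinarith
        · exact mul_le_mul_of_nonneg_right (by linarith) hD

end Main

theorem mainTheorem5 {m n L : ℕ} (A : Matrix (Fin m) (Fin n) ℝ →ₗ[ℝ] (Fin L → ℝ))
    (p q : ℝ) (hp : 0 < p) (hpq : p ≤ q) (hq : q ≤ 1)
    (r s : ℕ) (hr : 0 < r) (k : ℝ) (hk : 1 < k) (hs : k * (r : ℝ) = (s : ℝ))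
    (C₁ C₂ : ℝ) (hC₁ : 0 < C₁)
    -- the order `s + r` is `(k + 1) r`
    (hA : IsRUB A q (s + r) C₁ C₂)
    (hC : C₂ / C₁ < k ^ ((1 / p - 1 / 2) * q))
    (X Xmax : Matrix (Fin m) (Fin n) ℝ) (hX : schattenNorm p X = 1)
    (hXmax : IsBestRankApprox r X Xmax)
    (z b : Fin L → ℝ) (hb : b = A X + z)
    (Xhat : Matrix (Fin m) (Fin n) ℝ) (hXhat : IsLeastqSolution A b p q Xhat)
    (D₁ β₁ : ℝ) (hD₁ : D₁ = (C₁ * (L : ℝ)) ^ (-(p / q)))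
    (hβ₁ : β₁ = (C₂ * k ^ (-((1 / p - 1 / 2) * q)) / C₁) ^ (p / q)) :
    0 < D₁ ∧ 0 < β₁ ∧ β₁ < 1 ∧
      schattenNorm 2 (Xhat - X) ^ p ≤
        2 * (1 + β₁) ^ 2 / (1 - β₁) *
            (schattenNorm p (X - Xmax) ^ p / (r : ℝ) ^ ((1 / p - 1 / 2) * p)) +
          (2 : ℝ) ^ (p / q) * (3 + β₁) * D₁ / (1 - β₁) * lqNorm q z ^ p := by
  have hq0 : 0 < q := hp.trans_le hpq
  have hp1 : p ≤ 1 := hpq.trans hq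
  have hk0 : 0 < k := by linarith
  have hr' : (0 : ℝ) < r := Nat.cast_pos.2 hr
  have hs' : (0 : ℝ) < s := by rw [← hs]; positivity
  have hs0 : 0 < s := Nat.cast_pos.1 hs'
  have hpq0 : 0 < p / q := div_pos hp hq0
  have hpq1 : p / q ≤ 1 := (div_le_one hq0).2 hpq
  have hX0 : X ≠ 0 := by
    rintro rfl
    have h := schattenNorm_rpow hp (0 : Matrix (Fin m) (Fin n) ℝ) le_rfl
    rw [hX] at h
    simp [Real.zero_rpow hp.ne'] at h
  obtain ⟨hL, hC₁₂⟩ := hA.pos hq0 (by omega) hC₁ hX0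
  have hC₂ : 0 < C₂ := hC₁.trans_le hC₁₂
  have hL' : (0 : ℝ) < L := Nat.cast_pos.2 hL
  have hC₁L : 0 < C₁ * L := mul_pos hC₁ hL'
  have hD : 0 < D₁ := by rw [hD₁]; positivity
  have hβ : 0 < β₁ := by rw [hβ₁]; positivity
  have hβ1 : β₁ < 1 := by
    rw [hβ₁]
    refine Real.rpow_lt_one (by positivity) ?_ hpq0
    rw [Real.rpow_neg hk0.le, div_lt_one hC₁, ← div_eq_mul_inv, div_lt_iff₀ (by positivity)]
    rwa [div_lt_iff₀ hC₁, mul_comm] at hC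
  refine ⟨hD, hβ, hβ1, ?_⟩
  set H := Xhat - X with hH
  set R : ℝ := (r : ℝ) ^ (1 - p / 2) with hR
  have hR0 : 0 < R := by positivity
  have hRexp : (r : ℝ) ^ ((1 / p - 1 / 2) * p) = R := by
    rw [hR]
    congr 1
    field_simp
  rw [hRexp]
  set α : ℝ := (∑ j ∈ Finset.range (r + s),
    (Matrix.toEuclideanLin H).singularValues j ^ 2) with hα
  have hα0 : 0 ≤ α := Finset.sum_nonneg fun _ _ => sq_nonneg _
  set τ : ℝ := ∑ j ∈ Finset.range (n * s), (Matrix.toEuclideanLin H).singularValues (r + j) ^ p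
    with hτ
  have hτ0 : 0 ≤ τ := Finset.sum_nonneg fun _ _ =>
    Real.rpow_nonneg (LinearMap.singularValues_nonneg _ _) _
  set Z : ℝ := ∑ i, |z i| ^ q with hZ
  have hZ0 : 0 ≤ Z := Finset.sum_nonneg fun _ _ => Real.rpow_nonneg (abs_nonneg _) _
  set ε : ℝ := ∑ i, |A H i| ^ q with hε
  have hε0 : 0 ≤ ε := Finset.sum_nonneg fun _ _ => Real.rpow_nonneg (abs_nonneg _) _
  have hlz : lqNorm q z ^ p = Z ^ (p / q) := by
    rw [lqNorm, ← Real.rpow_mul hZ0]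
    congr 1
    ring
  have hεZ : ε ≤ 2 * Z := by
    have h1 := hXhat.2 X hX
    rw [lqNorm_rpow hq0, lqNorm_rpow hq0, hb] at h1
    have h2 : ∑ i, |(A X - (A X + z)) i| ^ q = Z := by simp [hZ]
    have h3 : A H = (A Xhat - (A X + z)) + z := by rw [hH, map_sub]; abel
    rw [hε, h3]
    have h4 := sum_abs_add_rpow_le (A Xhat - (A X + z)) z hq0 hq
    linarith
  set κ : ℝ := k ^ (-(1 - p / 2)) with hκ
  -- Since `s = k r`, the block factor splits: `κ` goes into `β₁`, while `R` scales the tails.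
  have hsκ : (s : ℝ) ^ (-(1 - p / 2)) = κ / R := by
    rw [← hs, Real.mul_rpow hk0.le hr'.le, Real.rpow_neg hr'.le, ← div_eq_mul_inv]
  have hκ1 : κ ≤ 1 := Real.rpow_le_one_of_one_le_of_nonpos hk.le (by linarith)
  have hκ0 : 0 < κ := by positivity
  have hβκ : β₁ = (C₂ / C₁) ^ (p / q) * κ := by
    rw [hβ₁, mul_div_right_comm, Real.mul_rpow (by positivity) (by positivity),
      ← Real.rpow_mul hk0.le, hκ]
    congr 2
    field_simp
  have hα1 : α ^ (p / 2) ≤ D₁ * ε ^ (p / q) + β₁ * (τ / R) := by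
    have h1 := hA.head_le hp hpq hq hs0 hL hC₂.le H
    rw [← hα, ← hτ, ← hε, hsκ] at h1
    have h2 := rpow_half_le_of_head_le hp hpq hα0 hε0 (mul_nonneg (by positivity) hτ0) hC₁ hL'
      hC₂.le h1
    rw [← hD₁] at h2
    refine h2.trans (le_of_eq ?_)
    rw [hβκ]
    ring
  have hnull := sum_singularValues_tail_le_head hp hp1 X Xhat (by rw [hX, hXhat.1]) r
    (M := n * s) ((min_le_right m n).trans (by nlinarith))
  have htail := sum_singularValues_tail_le hp X Xmax hXmax.1 (n * s)
  have hhead := Real.sum_rpow_le_mul_sum_sq_rpow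
    (LinearMap.singularValues_nonneg (Matrix.toEuclideanLin H)) hp hp1 hr
  have hheadα : (∑ i ∈ Finset.range r, (Matrix.toEuclideanLin H).singularValues i ^ 2) ^ (p / 2) ≤
      α ^ (p / 2) := by
    refine Real.rpow_le_rpow (Finset.sum_nonneg fun _ _ => sq_nonneg _) ?_ (by positivity)
    exact Finset.sum_le_sum_of_subset_of_nonneg (Finset.range_mono (by omega))
      fun _ _ _ => sq_nonneg _
  have hnorm := schattenNorm_two_rpow_le hp hp1 hs0 r H
  rw [← hα, ← hτ, hsκ] at hnorm
  rw [← hH, ← hτ] at hnull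
  set T : ℝ := schattenNorm p (X - Xmax) ^ p with hT
  have hT0 : 0 ≤ T := (Finset.sum_nonneg fun _ _ =>
    Real.rpow_nonneg (LinearMap.singularValues_nonneg _ _) _).trans htail
  have hεZ' : ε ^ (p / q) ≤ 2 ^ (p / q) * Z ^ (p / q) := by
    rw [← Real.mul_rpow two_pos.le hZ0]
    exact Real.rpow_le_rpow hε0 hεZ hpq0.le
  rw [hlz]
  set W : ℝ := 2 ^ (p / q) * Z ^ (p / q) with hW
  have hW0 : 0 ≤ W := by positivity
  have hα2 : α ^ (p / 2) ≤ D₁ * W + β₁ * (τ / R) :=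
    hα1.trans (add_le_add (mul_le_mul_of_nonneg_left hεZ' hD.le) le_rfl)
  have hτR : τ / R ≤ α ^ (p / 2) + 2 * (T / R) := by
    rw [div_le_iff₀ hR0]
    have h1 : τ ≤ R * α ^ (p / 2) + 2 * T := by
      have := mul_le_mul_of_nonneg_left hheadα hR0.le
      linarith
    refine h1.trans (le_of_eq ?_)
    field_simp
  -- The gain `κ ≤ 1` is discarded here, so that the same scaled tail appears in all three
  -- inequalities.
  have hτκ : κ / R * τ ≤ τ / R := by
    rw [div_mul_eq_mul_div]
    exact div_le_div_of_nonneg_right (mul_le_of_le_one_left hτ0 hκ1) hR0.le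
  refine (le_of_tail_le (D := D₁ * W) (by positivity) (div_nonneg hT0 hR0.le) hβ hβ1 hα2 hτR
    (hnorm.trans (add_le_add le_rfl hτκ))).trans (le_of_eq ?_)
  rw [hW]
  ring
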